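/- **Setting.** Let $B_r\subset\mathbb R^2$ be the open disc of radius $r$ centred at $0$ and let $\|\cdot\|$ be the Euclidean norm. Fix $0<\alpha\le 1$, $h>0$, $R>0$, $R_1\ge R$, $\delta_0>0$, $1<p<\infty$ and $a,b,c>0$, and put $\tilde R=R_1+1$, $p'=p/(p-1)$. Write $|Du|(D)$ for the total variation of the distributional derivative of $u$ in $D$, and $$d_{st}(u,v)=\int_{B_{\tilde R}}|u-v|\,dx+a\,\big||Du|(B_{\tilde R})-|Dv|(B_{\tilde R})\big|,\qquad u,v\in BV(B_{\tilde R}).$$ * Let $K\in C^{1,\alpha}(\mathbb R^2;\mathbb C)$ (meaning that $K$ is $C^1$ and its derivative is $\alpha$-Hölder on every ball) with $|K(x)|\to0$ as $\|x\|\to\infty$, and let $J(x)=\int_{\mathbb R^2}\hat J(\xi)e^{-i\xi\cdot x}\,d\xi$ for some $\hat J\in L^1(\mathbb R^2)$ with $\hat J\ge0$ a.e. Let $\Omega_0$ be an open set with $\overline{\Omega_0}\subset B_R$ and finite perimeter, i.e. $|D\chi_{\Omega_0}|(B_{R+1})<\infty$. * Let $A=\{u\in L^1(\mathbb R^2): 0\le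 u\le1 \text{ a.e.},\ u=0\text{ a.e. outside }B_R\}$ with the $L^1$ topology, and for $u\in A$ let $$\mathcal I(u)(x)=\int_{\mathbb R^2}\!\int_{\mathbb R^2}u(\xi)K(x-\xi)J(\xi-\zeta)\overline{K(x-\zeta)}u(\zeta)\,d\xi\,d\zeta ,$$ which is real. * Let $f:\mathbb R\to[0,+\infty]$ be continuous and nonincreasing, with $f=+\infty$ on $(-\infty,0]$, $f=0$ on $[\delta_0,\infty)$, and such that $\lim_{s\to0^+}f(s)s^{2/\alpha}$ exists in $(0,+\infty]$. Let $\varphi\in C^1(\mathbb R)$ be nondecreasing on $(-\infty,h]$ and nonincreasing on $[h,\infty)$, with $\varphi(h)>0$ and $\varphi(0)<-\delta_0$. Put $$\mathcal R(u)=\int_{\mathbb R^2}f\big(\|\nabla\mathcal I(u)\|^2-\varphi(\mathcal I(u))\big)\,dx\in[0,+\infty],\qquad u\in A.$$ * Let $\mathcal R_g:A\to[0,+\infty]$, $g\ge0$, be such that $\mathcal R_0=\mathcal R$; $\mathcal R_g$ is $L^1$-lower semicontinuous for each $g>0$; $\mathcal R_{g_2}\le\mathcal R_{g_1}\le\mathcal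 R$ for $0<g_1<g_2$; and $\mathcal R_g(u)\to\mathcal R(u)$ as $g\to0^+$ for every $u\in A$. * Let $\phi\in C^\infty(\mathbb R)$ be nondecreasing, with $\phi=0$ on $(-\infty,-1/2]$ and $\phi=1$ on $[1/2,\infty)$, and for $\tau>0$ put $\Phi_\tau(u)=\phi\big((\mathcal I(u)-h)/\tau\big)$. * Let $W:\mathbb R\to[0,\infty)$ be continuous with $W(t)=0$ if and only if $t\in\{0,1\}$, let $c_p=\big(\int_0^1W^{1/p'}\big)^{-1}$, and for $\varepsilon>0$ let $$\mathcal P_\varepsilon(u)=\frac{c_p}{p'\varepsilon}\int_{B_R}W(u)+\frac{c_p\,\varepsilon^{p-1}}{p}\int_{B_R}\|\nabla u\|^p$$ if $u\in W^{1,p}_0(B_R)$ and $u=0$ a.e. outside $B_R$, and $\mathcal P_\varepsilon(u)=+\infty$ otherwise. * Let $\eta:[0,\infty)\to[0,\infty)$ be continuous and strictly increasing with $\eta(0)=0$, and let $\gamma:[0,\infty)\to[0,\infty)$ be continuous and nondecreasing with $\gamma(0)=0$. For $\varepsilon>0$ define $F_\varepsilon:A\to[0,+\infty]$ by $$F_\varepsilon(u)=d_{st}\big(\Phi_{\eta(\varepsilon)}(u),\chi_{\Omega_0}\big)+b\,\mathcal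 P_\varepsilon(u)+c\,\mathcal R_{\gamma(\varepsilon)}(u).$$ **Proposition 3.7.** There exist $\tilde\varepsilon>0$ and a compact subset $\mathcal K$ of $A$ (in the $L^1$ topology) such that, for every $0<\varepsilon\le\tilde\varepsilon$, both minima below are attained and $$\min_{\mathcal K}F_\varepsilon=\min_AF_\varepsilon .$$ -/

import Mathlib

open MeasureTheory Filter Set Topology
open scoped ENNReal NNReal ContDiff ComplexConjugate

namespace Photolithography

/-- The plane `ℝ²` with its Euclidean norm, inner product and Lebesgue measure. -/
abbrev Plane : Type := EuclideanSpace ℝ (Fin 2)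

/-! ### Total variation and the strict distance -/

/-- The partial derivative `∂ψ/∂xᵢ` at `x`. -/
noncomputable def partialDeriv (i : Fin 2) (ψ : Plane → ℝ) (x : Plane) : ℝ :=
  fderiv ℝ ψ x (EuclideanSpace.single i 1)

/-- The divergence `∂₁ψ₁ + ∂₂ψ₂` of a planar vector field. -/
noncomputable def divergence (ψ : Plane → Plane) (x : Plane) : ℝ :=
  ∑ i : Fin 2, partialDeriv i (fun y => ψ y i) x

/-- The vector fields `ψ ∈ C¹_c(D; ℝ²)` with `‖ψ‖ ≤ 1` everywhere. -/
def unitFields (D : Set Plane) : Set (Plane → Plane) :=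
  {ψ | ContDiff ℝ 1 ψ ∧ HasCompactSupport ψ ∧ tsupport ψ ⊆ D ∧ ∀ x, ‖ψ x‖ ≤ 1}

/-- The total variation `|Du|(D)` of an integrable function `u` on the open set `D`,
`sup {∫_D u div ψ : ψ ∈ C¹_c(D; ℝ²), ‖ψ‖ ≤ 1} ∈ [0, +∞]`;
it is finite if and only if `u ∈ BV(D)`. -/
noncomputable def totalVariation (u : Plane → ℝ) (D : Set Plane) : ℝ≥0∞ :=
  ⨆ ψ ∈ unitFields D, ENNReal.ofReal (∫ x in D, u x * divergence ψ x)

/-- The characteristic function of a set. -/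
noncomputable def charFn (E : Set Plane) : Plane → ℝ := E.indicator (fun _ => 1)

/-- The strict distance
`d_st(u, v) = ∫_D |u - v| + a | |Du|(D) - |Dv|(D) |` for `u, v ∈ BV(D)`.
The absolute value of the difference of two elements of `[0, +∞]` is written as the larger of the
two truncated differences. -/
noncomputable def strictDist (a : ℝ) (D : Set Plane) (u v : Plane → ℝ) : ℝ≥0∞ :=
  (∫⁻ x in D, ENNReal.ofReal |u x - v x|) +
    ENNReal.ofReal a *
      max (totalVariation u D - totalVariation v D) (totalVariation v D - totalVariation u D)

/-! ### The Sobolev space `W₀^{1,p}` and the Modica–Mortola functional -/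

/-- The test functions `C^∞_c(D)`. -/
def testFunctions (D : Set Plane) : Set (Plane → ℝ) :=
  {ψ | ContDiff ℝ ∞ ψ ∧ HasCompactSupport ψ ∧ tsupport ψ ⊆ D}

/-- `G` is the weak gradient of `u` on the open set `D`. -/
def HasWeakGradient (D : Set Plane) (u : Plane → ℝ) (G : Plane → Plane) : Prop :=
  ∀ ψ ∈ testFunctions D, ∀ i : Fin 2,
    ∫ x in D, u x * partialDeriv i ψ x = - ∫ x in D, G x i * ψ x

/-- `u` belongs to `W₀^{1,p}(D)` and `G` is (a representative of) its weak gradient: `u` and `G`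
are in `L^p(D)`, `G` is the weak gradient of `u`, and `u` is the limit of test functions in the
norm of `W^{1,p}(D)`. -/
structure IsW0WithGradient (p : ℝ) (D : Set Plane) (u : Plane → ℝ) (G : Plane → Plane) :
    Prop where
  memLp : MemLp u (ENNReal.ofReal p) (volume.restrict D)
  memLp_gradient : MemLp G (ENNReal.ofReal p) (volume.restrict D)
  hasWeakGradient : HasWeakGradient D u G
  approx : ∃ ψ : ℕ → Plane → ℝ, (∀ n, ψ n ∈ testFunctions D) ∧
    Tendsto (fun n => eLpNorm (fun x => ψ n x - u x) (ENNReal.ofReal p) (volume.restrict D))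
      atTop (𝓝 0) ∧
    Tendsto (fun n => eLpNorm (fun x => gradient (ψ n) x - G x) (ENNReal.ofReal p)
      (volume.restrict D)) atTop (𝓝 0)

/-- The constant `c_p = (∫₀¹ W^{1/p'})⁻¹`, where `p' = p / (p - 1)`. -/
noncomputable def wellConst (p : ℝ) (W : ℝ → ℝ) : ℝ :=
  (∫ s in (0 : ℝ)..1, (W s) ^ (1 / Real.conjExponent p))⁻¹

/-- The Modica–Mortola functional
`P_ε(u) = c_p / (p' ε) ∫_{B_R} W(u) + c_p ε^{p-1} / p ∫_{B_R} ‖∇u‖^p`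
if `u ∈ W₀^{1,p}(B_R)` and `u = 0` a.e. outside `B_R`, and `P_ε(u) = +∞` otherwise.
The weak gradient is unique up to null sets, so that the infimum below is over a constant if `u` is
of this kind, and over the empty set (hence `+∞`) if it is not. -/
noncomputable def modicaMortola (p : ℝ) (W : ℝ → ℝ) (R ε : ℝ) (u : Plane → ℝ) : ℝ≥0∞ :=
  ⨅ (G : Plane → Plane) (_ : IsW0WithGradient p (Metric.ball 0 R) u G ∧
      ∀ᵐ x ∂(volume : Measure Plane), x ∉ Metric.ball (0 : Plane) R → u x = 0),
    ENNReal.ofReal (wellConst p W / (Real.conjExponent p * ε)) *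
        (∫⁻ x in Metric.ball (0 : Plane) R, ENNReal.ofReal (W (u x))) +
      ENNReal.ofReal (wellConst p W * ε ^ (p - 1) / p) *
        (∫⁻ x in Metric.ball (0 : Plane) R, ENNReal.ofReal (‖G x‖ ^ p))

/-! ### Masks, intensity and the regularization term -/

/-- The set `A` of the phase fields: `u ∈ L¹(ℝ²)` with `0 ≤ u ≤ 1` a.e. and `u = 0` a.e. outside
`B_R`. Its topology is that of the `L¹` norm. -/
def phaseFields (R : ℝ) : Set (Lp ℝ 1 (volume : Measure Plane)) :=
  {u | (∀ᵐ x ∂(volume : Measure Plane), 0 ≤ u x ∧ u x ≤ 1) ∧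
    ∀ᵐ x ∂(volume : Measure Plane), x ∉ Metric.ball (0 : Plane) R → u x = 0}

/-- `K ∈ C^{1,α}(ℝ²)`: continuously differentiable, with a derivative that is Hölder continuous of
exponent `α` on every ball (which holds in particular if the `C^{1,α}` norm over `ℝ²` is finite). -/
def IsC1Holder (α : ℝ≥0) (K : Plane → ℂ) : Prop :=
  ContDiff ℝ 1 K ∧ ∀ r : ℝ, ∃ C : ℝ≥0, HolderOnWith C α (fderiv ℝ K) (Metric.ball 0 r)

/-- `J` is the Fourier transform `J(x) = ∫ Jhat(ξ) e^{-i ξ·x} dξ` of a function `Jhat ∈ L¹(ℝ²)`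
which is nonnegative almost everywhere. -/
def IsFourierOfNonneg (J : Plane → ℂ) : Prop :=
  ∃ Jhat : Plane → ℝ, Integrable Jhat ∧ (∀ᵐ ξ ∂(volume : Measure Plane), 0 ≤ Jhat ξ) ∧
    ∀ x, J x = ∫ ξ, (Jhat ξ : ℂ) * Complex.exp (-(Complex.I * (inner ℝ ξ x : ℝ)))

/-- The Hopkins aerial intensity
`I(u)(x) = ∫∫ u(ξ) K(x-ξ) J(ξ-η) conj(K(x-η)) u(η) dξ dη`.
The double integral is real (indeed nonnegative) because `J` is the Fourier transform of a
nonnegative function; taking the real part only makes this visible in the type. -/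
noncomputable def intensity (K J : Plane → ℂ) (u : Plane → ℝ) (x : Plane) : ℝ :=
  (∫ η, ∫ ξ, (u ξ : ℂ) * K (x - ξ) * J (ξ - η) * conj (K (x - η)) * (u η : ℂ)).re

/-- The regularization term `R(u) = ∫_{ℝ²} f(‖∇I(u)‖² - φ(I(u)))`. -/
noncomputable def regularization (K J : Plane → ℂ) (f : ℝ → ℝ≥0∞) (φ : ℝ → ℝ)
    (u : Plane → ℝ) : ℝ≥0∞ :=
  ∫⁻ x, f (‖gradient (intensity K J u) x‖ ^ 2 - φ (intensity K J u x))

/-- The smoothed exposed pattern `Φ_η(u)(x) = ϕ((I(u)(x) - h) / η)`. -/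
noncomputable def smoothPattern (K J : Plane → ℂ) (ϕ : ℝ → ℝ) (h η : ℝ) (u : Plane → ℝ)
    (x : Plane) : ℝ :=
  ϕ ((intensity K J u x - h) / η)

/-- The approximating functional
`F_ε(u) = d_st(Φ_{η(ε)}(u), χ_{Ω₀}) + b P_ε(u) + c R_{γ(ε)}(u)` on `A`, where `d_st` is the strict
distance of `BV(B_{R'})`, and `Reg g` stands for the functional `R_g` on `A`. -/
noncomputable def approxFunctional (K J : Plane → ℂ) (ϕ : ℝ → ℝ) (h : ℝ) (Ω₀ : Set Plane)
    (p : ℝ) (W : ℝ → ℝ) (R R' a b c : ℝ) (Reg : ℝ → phaseFields R → ℝ≥0∞) (η γ : ℝ → ℝ)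
    (ε : ℝ) (u : phaseFields R) : ℝ≥0∞ :=
  strictDist a (Metric.ball 0 R') (smoothPattern K J ϕ h (η ε) u.1) (charFn Ω₀) +
    ENNReal.ofReal b * modicaMortola p W R ε u.1 +
    ENNReal.ofReal c * Reg (γ ε) u

end Photolithography

open Photolithography

namespace Photolithography

/-! ### Uniform convexity of `Lᵖ` -/

/-! The proof is the direct method, with a compact set that does not depend on `ε`.

The zero field is a competitor of uniformly bounded energy. Its intensity vanishes, so once `η ε ≤ 2
* h` its smoothed pattern is `ϕ (-h / η ε) = 0`. Its Modica–Mortola energy is zero because `W 0 =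
0`, and its regularization term is zero because `-φ 0 > δ₀`. Hence `F_ε(0) = C₀`, the strict
distance of `0` to the target, which is finite and independent of `ε`. Only the fields with `F_ε ≤
C₀` matter, and for them `P_ε ≤ C₀ / b`.

Young's inequality bounds the `L¹` norm of the gradient of `Ψ ∘ u` by `P_ε(u)`, where `Ψ` is the
primitive `profile` of `c_p W^{1/p'}`. In terms of translations, `‖Ψ(u(· + τ)) - Ψ(u)‖₁ ≤ P_ε(u)
‖τ‖` (`lintegral_profile_translation_le`), with no other dependence on `ε`. The set `𝒦` of the
fields satisfying this estimate with constant `C₀ / b` therefore contains every sublevel set `{F_ε ≤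
C₀}`. It is compact (`isCompact_translationBounded`): a Kolmogorov–Riesz argument handles `Ψ ∘ u`,
and strict monotonicity of `Ψ` on `[0, 1]` brings the convergence back to `u`.

It remains to see that `F_ε` is lower semicontinuous on `A`. The fidelity term is even continuous,
because the intensity and its gradient are Lipschitz in `u` for the `L¹` norm, uniformly on balls
(`intensity_sub_le`). The potential term, and the regularization term at `g = 0`, follow from
Fatou's lemma. The gradient term rests on uniform convexity of `Lᵖ`: near-minimal norms in nested
convex sets give strong limits, so no weak topology is used (`exists_norm_le_of_seq_of_convex`). A
minimizer over `𝒦` then exists, and it minimizes over `A` because every field outside `𝒦` has energy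
above `C₀`. -/

theorem eq_of_norm_midpoint_rpow_le {E : Type*} [NormedAddCommGroup E]
    [InnerProductSpace ℝ E] {p : ℝ} (hp : 1 < p) (x y : E)
    (h : (‖x‖ ^ p + ‖y‖ ^ p) / 2 ≤ ‖(1 / 2 : ℝ) • (x + y)‖ ^ p) : x = y := by
  have hp0 : 0 < p := by linarith
  have hmid : ‖(1 / 2 : ℝ) • (x + y)‖ = ‖x + y‖ / 2 := by
    rw [norm_smul]; norm_num; ring
  have hle : ‖x + y‖ / 2 ≤ (1 / 2 : ℝ) * ‖x‖ + (1 / 2 : ℝ) * ‖y‖ := by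
    linarith [norm_add_le x y]
  -- Different norms would make the hypothesis contradict strict convexity of `t ↦ t ^ p`. With
  -- equal norms the hypothesis forces equality in the triangle inequality, and strict convexity of
  -- the norm concludes.
  have hnorm : ‖x‖ = ‖y‖ := by
    by_contra hne
    have := (strictConvexOn_rpow hp).2 (norm_nonneg x) (norm_nonneg y) hne
      (show (0 : ℝ) < 1 / 2 by norm_num) (show (0 : ℝ) < 1 / 2 by norm_num) (by norm_num)
    simp only [smul_eq_mul] at this
    have h2 := Real.rpow_le_rpow (by positivity) hle hp0.le
    rw [hmid] at h
    linarith
  have h3 : ‖x‖ ≤ ‖x + y‖ / 2 := by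
    rw [hmid, ← hnorm] at h
    have : ‖x‖ ^ p ≤ (‖x + y‖ / 2) ^ p := by linarith
    exact (Real.rpow_le_rpow_iff (norm_nonneg _) (by positivity) hp0).1 this
  refine eq_of_norm_eq_of_norm_add_eq hnorm ?_
  linarith [norm_add_le x y]

/-- Both sides are homogeneous of degree `p`, so the unit sphere of `E × E` suffices. The points of
the sphere where the `e`-term alone does not strictly dominate form a compact set; the convexity
deficit `dfc` is positive there, since zero deficit means `x = y`, hence is bounded away from zero.
Integrating this pointwise estimate yields uniform convexity of `Lᵖ` for every `p > 1` at once. -/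
theorem exists_norm_sub_rpow_le {E : Type*} [NormedAddCommGroup E] [InnerProductSpace ℝ E]
    [FiniteDimensional ℝ E] {p : ℝ} (hp : 1 < p) {e : ℝ} (he : 0 < e) :
    ∃ C : ℝ, 0 < C ∧ ∀ x y : E, ‖x - y‖ ^ p ≤ e * (‖x‖ ^ p + ‖y‖ ^ p)
      + C * ((‖x‖ ^ p + ‖y‖ ^ p) / 2 - ‖(1 / 2 : ℝ) • (x + y)‖ ^ p) := by
  have hp0 : 0 < p := by linarith
  let dfc : E × E → ℝ := fun z => (‖z.1‖ ^ p + ‖z.2‖ ^ p) / 2 - ‖(1 / 2 : ℝ) • (z.1 + z.2)‖ ^ p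
  have hcn : Continuous fun z : E => ‖z‖ ^ p := continuous_norm.rpow_const fun _ => Or.inr hp0.le
  have hdc : Continuous dfc := by
    refine (((hcn.comp continuous_fst).add (hcn.comp continuous_snd)).div_const 2).sub ?_
    exact hcn.comp (by fun_prop)
  have hd0 : ∀ z, 0 ≤ dfc z := by
    intro z
    have h1 : ‖(1 / 2 : ℝ) • (z.1 + z.2)‖ ≤ (1 / 2 : ℝ) * ‖z.1‖ + (1 / 2 : ℝ) * ‖z.2‖ := by
      rw [norm_smul]; norm_num
      linarith [norm_add_le z.1 z.2]
    have h2 := Real.rpow_le_rpow (norm_nonneg _) h1 hp0.le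
    have h3 := (convexOn_rpow hp.le).2 (norm_nonneg z.1) (norm_nonneg z.2)
      (show (0 : ℝ) ≤ 1 / 2 by norm_num) (show (0 : ℝ) ≤ 1 / 2 by norm_num) (by norm_num)
    simp only [smul_eq_mul] at h3
    simp only [dfc]
    linarith
  have hgc : Continuous fun z : E × E => ‖z.1 - z.2‖ ^ p := hcn.comp (by fun_prop)
  obtain ⟨C, hC, key⟩ : ∃ C : ℝ, 0 < C ∧ ∀ z : E × E, ‖z‖ = 1 →
      ‖z.1 - z.2‖ ^ p ≤ e * (‖z.1‖ ^ p + ‖z.2‖ ^ p) + C * dfc z := by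
    let S : Set (E × E) := {z | ‖z‖ = 1 ∧ e * (‖z.1‖ ^ p + ‖z.2‖ ^ p) ≤ ‖z.1 - z.2‖ ^ p}
    have hSc : IsCompact S := by
      refine (isCompact_sphere (0 : E × E) 1).of_isClosed_subset ?_ ?_
      · refine (isClosed_eq continuous_norm continuous_const).inter ?_
        exact isClosed_le
          (continuous_const.mul ((hcn.comp continuous_fst).add (hcn.comp continuous_snd))) hgc
      · intro z hz; simpa using hz.1
    have hSpos : ∀ z ∈ S, 0 < dfc z := by
      intro z hz
      refine lt_of_le_of_ne (hd0 z) fun h0 => ?_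
      have hxy := eq_of_norm_midpoint_rpow_le hp z.1 z.2 (by
        simp only [dfc] at h0; linarith)
      have h2 := hz.2
      rw [hxy, sub_self, norm_zero, Real.zero_rpow hp0.ne'] at h2
      have hz2 : ‖z.2‖ ^ p ≤ 0 := by
        by_contra hcon
        have := mul_pos he (not_le.1 hcon)
        linarith
      have hz2' : ‖z.2‖ = 0 := by
        by_contra hne
        have : 0 < ‖z.2‖ := lt_of_le_of_ne (norm_nonneg _) (Ne.symm hne)
        linarith [Real.rpow_pos_of_pos this p]
      have : z = 0 := Prod.ext (by rw [hxy]; simpa using hz2') (by simpa using hz2')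
      have h1 := hz.1
      rw [this, norm_zero] at h1
      exact zero_ne_one h1
    rcases S.eq_empty_or_nonempty with hS | hS
    · refine ⟨1, one_pos, fun z hz => ?_⟩
      have : z ∉ S := by rw [hS]; exact notMem_empty _
      have : ¬ (e * (‖z.1‖ ^ p + ‖z.2‖ ^ p) ≤ ‖z.1 - z.2‖ ^ p) := fun h => this ⟨hz, h⟩
      linarith [hd0 z]
    · obtain ⟨z₀, hz₀, hmin⟩ := hSc.exists_isMinOn hS hdc.continuousOn
      obtain ⟨B, hB⟩ := hSc.bddAbove_image hgc.continuousOn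
      have hp0' := hSpos z₀ hz₀
      -- `B` bounds `‖x - y‖ ^ p` on `S` and `dfc z₀` is the least deficit there; the maximum with
      -- `1` only makes the constant positive.
      refine ⟨max B 1 / dfc z₀, by positivity, fun z hz => ?_⟩
      by_cases hzS : z ∈ S
      · have h1 : ‖z.1 - z.2‖ ^ p ≤ max B 1 := (hB ⟨z, hzS, rfl⟩).trans (le_max_left _ _)
        have h2 : dfc z₀ ≤ dfc z := hmin hzS
        have h3 : max B 1 ≤ max B 1 / dfc z₀ * dfc z := by
          rw [div_mul_eq_mul_div, le_div_iff₀ hp0']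
          exact mul_le_mul_of_nonneg_left h2 (by positivity)
        have : 0 ≤ e * (‖z.1‖ ^ p + ‖z.2‖ ^ p) := by positivity
        linarith
      · have : ¬ (e * (‖z.1‖ ^ p + ‖z.2‖ ^ p) ≤ ‖z.1 - z.2‖ ^ p) := fun h => hzS ⟨hz, h⟩
        have h2 : 0 ≤ max B 1 / dfc z₀ * dfc z := mul_nonneg (by positivity) (hd0 z)
        linarith
  refine ⟨C, hC, fun x y => ?_⟩
  set t : ℝ := ‖(x, y)‖ with ht
  rcases eq_or_ne t 0 with h0 | h0
  · have hxy : (x, y) = (0 : E × E) := norm_eq_zero.1 h0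
    obtain ⟨rfl, rfl⟩ := Prod.mk.inj hxy
    simp [Real.zero_rpow hp0.ne']
  · have htp : 0 < t := lt_of_le_of_ne (norm_nonneg _) (Ne.symm h0)
    have h1 := key (t⁻¹ • (x, y)) (by
      rw [norm_smul, Real.norm_of_nonneg (inv_nonneg.2 htp.le), ← ht, inv_mul_cancel₀ h0])
    have hsc : ∀ w : E, ‖t⁻¹ • w‖ ^ p = t⁻¹ ^ p * ‖w‖ ^ p := fun w => by
      rw [norm_smul, Real.norm_of_nonneg (inv_nonneg.2 htp.le),
        Real.mul_rpow (inv_nonneg.2 htp.le) (norm_nonneg _)]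
    simp only [dfc, Prod.smul_fst, Prod.smul_snd, ← smul_sub, ← smul_add] at h1
    rw [smul_comm (1 / 2 : ℝ) t⁻¹, hsc, hsc, hsc, hsc] at h1
    have hq : 0 < t⁻¹ ^ p := Real.rpow_pos_of_pos (inv_pos.2 htp) p
    refine le_of_mul_le_mul_left ?_ hq
    linarith

theorem norm_rpow_eq_integral {α E : Type*} [MeasurableSpace α] [NormedAddCommGroup E]
    {μ : Measure α} {p : ℝ} (hp : 1 < p) (f : Lp E (ENNReal.ofReal p) μ) :
    ‖f‖ ^ p = ∫ x, ‖f x‖ ^ p ∂μ := by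
  have hp0 : 0 < p := by linarith
  have h0 : ENNReal.ofReal p ≠ 0 := by simpa using hp0
  have h1 := (Lp.memLp f).eLpNorm_eq_integral_rpow_norm h0 ENNReal.ofReal_ne_top
  rw [ENNReal.toReal_ofReal hp0.le] at h1
  rw [Lp.norm_def, h1, ENNReal.toReal_ofReal (by positivity), ← Real.rpow_mul (by positivity),
    inv_mul_cancel₀ hp0.ne', Real.rpow_one]

theorem integrable_norm_rpow_Lp {α E : Type*} [MeasurableSpace α] [NormedAddCommGroup E]
    {μ : Measure α} {p : ℝ} (hp : 1 < p) (f : Lp E (ENNReal.ofReal p) μ) :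
    Integrable (fun x => ‖f x‖ ^ p) μ := by
  have hp0 : 0 < p := by linarith
  have h1 := (Lp.memLp f).integrable_norm_rpow (by simpa using hp0) ENNReal.ofReal_ne_top
  rwa [ENNReal.toReal_ofReal hp0.le] at h1

/-- For unit vectors at distance at least `e`, the integrated estimate with parameter `e ^ p / 4`
reads `e ^ p ≤ e ^ p / 2 + C (1 - ‖midpoint‖ ^ p)`, which keeps the midpoint away from the unit
sphere. -/
theorem uniformConvexSpace_Lp {α E : Type*} [MeasurableSpace α] [NormedAddCommGroup E]
    [InnerProductSpace ℝ E] [FiniteDimensional ℝ E] {μ : Measure α} {p : ℝ} (hp : 1 < p)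
    [Fact (1 ≤ ENNReal.ofReal p)] : UniformConvexSpace (Lp E (ENNReal.ofReal p) μ) := by
  have hp0 : 0 < p := by linarith
  refine ⟨fun e he => ?_⟩
  have hep : 0 < e ^ p := Real.rpow_pos_of_pos he p
  obtain ⟨C, hC, hineq⟩ := exists_norm_sub_rpow_le (E := E) hp (show 0 < e ^ p / 4 by positivity)
  have hκ : 1 - e ^ p / (2 * C) < 1 := by
    have : 0 < e ^ p / (2 * C) := by positivity
    linarith
  -- The truncation at `0` makes the root `q ^ (1 / p)` monotone in the quantity it bounds, even if
  -- `C` is small.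
  set q : ℝ := max 0 (1 - e ^ p / (2 * C)) with hq
  have hq1 : q < 1 := max_lt one_pos hκ
  have hq0 : 0 ≤ q := le_max_left _ _
  refine ⟨2 - 2 * q ^ (1 / p), ?_, fun f hf g hg hfg => ?_⟩
  · have : q ^ (1 / p) < 1 := Real.rpow_lt_one hq0 hq1 (by positivity)
    linarith
  · have hint : ‖f - g‖ ^ p ≤ e ^ p / 4 * (‖f‖ ^ p + ‖g‖ ^ p)
        + C * ((‖f‖ ^ p + ‖g‖ ^ p) / 2 - ‖(1 / 2 : ℝ) • (f + g)‖ ^ p) := by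
      have hIf := integrable_norm_rpow_Lp hp f
      have hIg := integrable_norm_rpow_Lp hp g
      have hIm := integrable_norm_rpow_Lp hp ((1 / 2 : ℝ) • (f + g))
      have hS : Integrable (fun x => ‖f x‖ ^ p + ‖g x‖ ^ p) μ := hIf.add hIg
      have hT : Integrable (fun x => (‖f x‖ ^ p + ‖g x‖ ^ p) / 2
          - ‖((1 / 2 : ℝ) • (f + g) : Lp E (ENNReal.ofReal p) μ) x‖ ^ p) μ :=
        (hS.div_const 2).sub hIm
      rw [norm_rpow_eq_integral hp, norm_rpow_eq_integral hp f, norm_rpow_eq_integral hp g,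
        norm_rpow_eq_integral hp ((1 / 2 : ℝ) • (f + g)), ← integral_add hIf hIg,
        ← integral_div, ← integral_sub (hS.div_const 2) hIm, ← integral_const_mul,
        ← integral_const_mul, ← integral_add (hS.const_mul _) (hT.const_mul _)]
      refine integral_mono_ae (integrable_norm_rpow_Lp hp (f - g))
        ((hS.const_mul _).add (hT.const_mul _)) ?_
      filter_upwards [Lp.coeFn_sub f g, Lp.coeFn_add f g, Lp.coeFn_smul (1 / 2 : ℝ) (f + g)]
        with x h1 h2 h3
      simp only [h1, h3, Pi.smul_apply, h2, Pi.sub_apply, Pi.add_apply]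
      exact hineq (f x) (g x)
    rw [hf, hg, Real.one_rpow] at hint
    have h1 : e ^ p ≤ ‖f - g‖ ^ p := Real.rpow_le_rpow he.le hfg hp0.le
    have h2 : ‖(1 / 2 : ℝ) • (f + g)‖ ^ p ≤ 1 - e ^ p / (2 * C) := by
      have : e ^ p / 2 ≤ C * (1 - ‖(1 / 2 : ℝ) • (f + g)‖ ^ p) := by linarith
      have h4 : e ^ p / (2 * C) ≤ 1 - ‖(1 / 2 : ℝ) • (f + g)‖ ^ p := by
        rw [div_le_iff₀ (by positivity)]
        linarith
      linarith
    have h3 : ‖(1 / 2 : ℝ) • (f + g)‖ ≤ q ^ (1 / p) := by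
      have := Real.rpow_le_rpow (by positivity) (h2.trans (le_max_right 0 _))
        (show 0 ≤ 1 / p by positivity)
      rwa [← Real.rpow_mul (norm_nonneg _), mul_one_div_cancel hp0.ne', Real.rpow_one] at this
    rw [norm_smul] at h3
    norm_num at h3 ⊢
    linarith

/-- This plays the role of weak compactness together with Mazur's lemma. The fibres of `V` over
shrinking balls around `x₀` are nested and midpoint-convex, and their distances to the origin
increase to some `D ≤ M`. By uniform convexity nearly minimal elements form a Cauchy sequence; its
limit lies over `x₀` because `V` is closed. -/
theorem exists_norm_le_of_seq_of_convex {X Y : Type*} [NormedAddCommGroup X] [NormedSpace ℝ X]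
    [NormedAddCommGroup Y] [NormedSpace ℝ Y] [CompleteSpace Y] [UniformConvexSpace Y]
    {V : Set (X × Y)} (hVc : Convex ℝ V) (hV : IsClosed V) {x : ℕ → X} {x₀ : X}
    (hx : Tendsto x atTop (𝓝 x₀)) {M : ℝ} (hM : ∀ n, ∃ y, (x n, y) ∈ V ∧ ‖y‖ ≤ M) :
    ∃ y, (x₀, y) ∈ V ∧ ‖y‖ ≤ M := by
  let s : ℕ → ℝ := fun k => 1 / ((k : ℝ) + 1)
  have hs0 : ∀ k, 0 < s k := fun k => by positivity
  have hs : Tendsto s atTop (𝓝 0) := tendsto_one_div_add_atTop_nhds_zero_nat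
  have hs_anti : Antitone s := fun i j hij => by
    have : (i : ℝ) ≤ j := by exact_mod_cast hij
    exact one_div_le_one_div_of_le (by positivity) (by linarith)
  let C : ℕ → Set Y := fun k => {y | ∃ z, (z, y) ∈ V ∧ ‖z - x₀‖ ≤ s k}
  have hCanti : ∀ {i j}, i ≤ j → C j ⊆ C i := by
    rintro i j hij y ⟨z, hz, hz'⟩
    exact ⟨z, hz, hz'.trans (hs_anti hij)⟩
  have hCconv : ∀ k, ∀ y ∈ C k, ∀ y' ∈ C k, (1 / 2 : ℝ) • (y + y') ∈ C k := by
    rintro k y ⟨z, hz, hz'⟩ y' ⟨w, hw, hw'⟩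
    refine ⟨(1 / 2 : ℝ) • z + (1 / 2 : ℝ) • w, ?_, ?_⟩
    · have := hVc hz hw (a := 1 / 2) (b := 1 / 2) (by norm_num) (by norm_num) (by norm_num)
      simpa [smul_add] using this
    · have : (1 / 2 : ℝ) • z + (1 / 2 : ℝ) • w - x₀
          = (1 / 2 : ℝ) • (z - x₀) + (1 / 2 : ℝ) • (w - x₀) := by
        have h2 : x₀ = (1 / 2 : ℝ) • x₀ + (1 / 2 : ℝ) • x₀ := by
          rw [← add_smul]; norm_num
        rw [smul_sub, smul_sub]
        nth_rewrite 1 [h2]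
        abel
      rw [this]
      refine (norm_add_le _ _).trans ?_
      rw [norm_smul, norm_smul]
      norm_num
      linarith
  have hCM : ∀ k, ∃ y ∈ C k, ‖y‖ ≤ M := by
    intro k
    have : ∀ᶠ n in atTop, ‖x n - x₀‖ < s k := by
      have h1 := (tendsto_iff_norm_sub_tendsto_zero.1 hx).eventually (gt_mem_nhds (hs0 k))
      exact h1
    obtain ⟨n, hn⟩ := this.exists
    obtain ⟨y, hy, hy'⟩ := hM n
    exact ⟨y, ⟨x n, hy, hn.le⟩, hy'⟩
  let d : ℕ → ℝ := fun k => sInf (norm '' C k)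
  have hbdd : ∀ k, BddBelow (norm '' C k) := fun k => ⟨0, by rintro _ ⟨y, _, rfl⟩; positivity⟩
  have hd_le : ∀ k, ∀ y ∈ C k, d k ≤ ‖y‖ := fun k y hy => csInf_le (hbdd k) ⟨y, hy, rfl⟩
  have hne : ∀ k, (norm '' C k).Nonempty := fun k => by
    obtain ⟨y, hy, -⟩ := hCM k
    exact ⟨_, y, hy, rfl⟩
  have hdM : ∀ k, d k ≤ M := fun k => by
    obtain ⟨y, hy, hy'⟩ := hCM k
    exact (hd_le k y hy).trans hy'
  have hd0 : ∀ k, 0 ≤ d k := fun k =>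
    le_csInf (hne k) (by rintro _ ⟨y, _, rfl⟩; positivity)
  have hdmono : Monotone d := fun i j hij =>
    csInf_le_csInf (hbdd i) (hne j) (image_mono (hCanti hij))
  have hbddA : BddAbove (range d) := ⟨M, by rintro _ ⟨k, rfl⟩; exact hdM k⟩
  set D : ℝ := ⨆ k, d k with hD
  have hdt : Tendsto d atTop (𝓝 D) := tendsto_atTop_ciSup hdmono hbddA
  have hDM : D ≤ M := ciSup_le hdM
  have hdD : ∀ k, d k ≤ D := fun k => le_ciSup hbddA k
  have hD0 : 0 ≤ D := (hd0 0).trans (hdD 0)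
  have hyex : ∀ k, ∃ y ∈ C k, ‖y‖ < D + s k := by
    intro k
    obtain ⟨_, ⟨y, hy, rfl⟩, hy'⟩ := exists_lt_of_csInf_lt (hne k)
      (show sInf (norm '' C k) < D + s k from (hdD k).trans_lt (by linarith [hs0 k]))
    exact ⟨y, hy, hy'⟩
  choose y hyC hyn using hyex
  have hcauchy : CauchySeq y := by
    rw [Metric.cauchySeq_iff]
    intro e he
    obtain ⟨δ, hδ, huc⟩ :=
      exists_forall_closed_ball_dist_add_le_two_mul_sub Y (half_pos he) D
    have e1 : ∀ᶠ k in atTop, s k < min (e / 4) (δ / 4) :=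
      hs.eventually (gt_mem_nhds (by positivity))
    have e2 : ∀ᶠ k in atTop, D - δ / 8 < d k := hdt.eventually (lt_mem_nhds (by linarith))
    obtain ⟨N, hN⟩ := eventually_atTop.1 (e1.and e2)
    refine ⟨N, fun k hk l hl => ?_⟩
    -- Uniform convexity is applied in the fixed ball of radius `D`, so `y k` is shrunk into it, at
    -- a cost of at most `s k`.
    let y' : ℕ → Y := fun k => (D / (D + s k)) • y k
    have hy'n : ∀ k, ‖y' k‖ ≤ D := by
      intro k
      have hp : 0 < D + s k := by linarith [hs0 k]
      rw [norm_smul, Real.norm_of_nonneg (by positivity), div_mul_eq_mul_div, div_le_iff₀ hp]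
      exact mul_le_mul_of_nonneg_left (hyn k).le hD0
    have hy'y : ∀ k, ‖y k - y' k‖ ≤ s k := by
      intro k
      have hp : 0 < D + s k := by linarith [hs0 k]
      have : y k - y' k = (s k / (D + s k)) • y k := by
        have h1 : s k / (D + s k) = 1 - D / (D + s k) := by field_simp; ring
        rw [h1, sub_smul, one_smul]
      rw [this, norm_smul, Real.norm_of_nonneg (by have := hs0 k; positivity),
        div_mul_eq_mul_div, div_le_iff₀ hp]
      exact mul_le_mul_of_nonneg_left (hyn k).le (hs0 k).le
    have h1k := (hN k hk).1
    have h1l := (hN l hl).1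
    rw [lt_min_iff] at h1k h1l
    -- The midpoint lies in `C N`, whose elements have norm above `D - δ / 8`. If `y' k` and `y' l`
    -- were `e / 2` apart, the sum would have norm at most `2 D - δ + s k + s l < 2 D - δ / 2`, a
    -- contradiction.
    have hsum : 2 * (D - δ / 8) < ‖y k + y l‖ := by
      have hmem : (1 / 2 : ℝ) • (y k + y l) ∈ C N :=
        hCconv N _ (hCanti hk (hyC k)) _ (hCanti hl (hyC l))
      have h2 := hd_le N _ hmem
      rw [norm_smul] at h2
      norm_num at h2
      linarith [(hN N le_rfl).2]
    have hlt : ‖y' k - y' l‖ < e / 2 := by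
      by_contra hcon
      have h3 := huc (hy'n k) (hy'n l) (not_lt.1 hcon)
      have h4 : ‖y k + y l‖ ≤ ‖y' k + y' l‖ + ‖y k - y' k‖ + ‖y l - y' l‖ := by
        have : y k + y l = (y' k + y' l) + (y k - y' k) + (y l - y' l) := by abel
        rw [this]
        exact norm_add₃_le
      linarith [hy'y k, hy'y l]
    rw [dist_eq_norm]
    have h5 : ‖y k - y l‖ ≤ ‖y' k - y' l‖ + ‖y k - y' k‖ + ‖y l - y' l‖ := by
      have : y k - y l = (y' k - y' l) + (y k - y' k) - (y l - y' l) := by abel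
      rw [this]
      exact (norm_sub_le _ _).trans (add_le_add_left (norm_add_le _ _) _)
    linarith [hy'y k, hy'y l]
  obtain ⟨y₀, hy₀⟩ := cauchySeq_tendsto_of_complete hcauchy
  choose z hzV hz using hyC
  have hz0 : Tendsto z atTop (𝓝 x₀) := by
    rw [tendsto_iff_norm_sub_tendsto_zero]
    exact squeeze_zero (fun _ => norm_nonneg _) hz hs
  refine ⟨y₀, hV.mem_of_tendsto (hz0.prodMk_nhds hy₀) (Eventually.of_forall hzV), ?_⟩
  have h1 : Tendsto (fun k => D + s k) atTop (𝓝 (D + 0)) := tendsto_const_nhds.add hs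
  rw [add_zero] at h1
  exact (le_of_tendsto_of_tendsto' hy₀.norm h1 fun k => (hyn k).le).trans hDM

/-! ### Calculus of test functions -/

theorem gradient_apply (ψ : Plane → ℝ) (x : Plane) (i : Fin 2) :
    gradient ψ x i = partialDeriv i ψ x := by
  have h := inner_gradient_left (𝕜 := ℝ) (f := ψ) (x := x) (y := EuclideanSpace.single i 1)
  rw [EuclideanSpace.inner_single_right] at h
  simpa [partialDeriv] using h

theorem norm_gradient (ψ : Plane → ℝ) (x : Plane) : ‖gradient ψ x‖ = ‖fderiv ℝ ψ x‖ := by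
  simp [gradient]

theorem abs_partialDeriv_le (i : Fin 2) (ψ : Plane → ℝ) (x : Plane) :
    |partialDeriv i ψ x| ≤ ‖fderiv ℝ ψ x‖ := by
  have := (fderiv ℝ ψ x).le_opNorm (EuclideanSpace.single i 1)
  simpa [partialDeriv] using this

theorem continuous_gradient {ψ : Plane → ℝ} (h : ContDiff ℝ 1 ψ) : Continuous (gradient ψ) :=
  (LinearIsometryEquiv.continuous _).comp (h.continuous_fderiv one_ne_zero)

theorem hasCompactSupport_gradient {ψ : Plane → ℝ} (h : HasCompactSupport ψ) :
    HasCompactSupport (gradient ψ) :=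
  (h.fderiv ℝ).comp_left (g := (InnerProductSpace.toDual ℝ Plane).symm) (map_zero _)

theorem partialDeriv_eq_zero_of_notMem {i : Fin 2} {ψ : Plane → ℝ} {x : Plane}
    (hx : x ∉ tsupport ψ) : partialDeriv i ψ x = 0 := by
  have : fderiv ℝ ψ x = 0 := by
    by_contra h
    exact hx (tsupport_fderiv_subset ℝ (subset_tsupport _ h))
  simp [partialDeriv, this]

theorem continuous_partialDeriv {ψ : Plane → ℝ} (h : ContDiff ℝ 1 ψ) (i : Fin 2) :
    Continuous (partialDeriv i ψ) :=
  (h.continuous_fderiv one_ne_zero).clm_apply continuous_const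

theorem hasCompactSupport_partialDeriv {ψ : Plane → ℝ} (h : HasCompactSupport ψ) (i : Fin 2) :
    HasCompactSupport (partialDeriv i ψ) :=
  HasCompactSupport.intro (K := tsupport ψ) h fun _ hx => partialDeriv_eq_zero_of_notMem hx

/-- Integration by parts of a differentiable function with locally bounded derivative against a
compactly supported `C¹` function. -/
theorem integral_mul_partialDeriv {w ψ : Plane → ℝ} (hw : Differentiable ℝ w)
    (hwb : ∀ r : ℝ, ∃ C, ∀ x ∈ Metric.ball (0 : Plane) r, ‖fderiv ℝ w x‖ ≤ C)
    (hψ : ContDiff ℝ 1 ψ) (hc : HasCompactSupport ψ) (i : Fin 2) :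
    ∫ x, w x * partialDeriv i ψ x = - ∫ x, partialDeriv i w x * ψ x := by
  refine integral_mul_fderiv_eq_neg_fderiv_mul_of_integrable ?_ ?_ ?_
    (fun x _ => hw x) (fun x _ => hψ.differentiable one_ne_zero x)
  · obtain ⟨r, hr⟩ := hc.isCompact.isBounded.subset_ball (0 : Plane)
    obtain ⟨C, hC⟩ := hwb r
    have hI : Integrable ψ := hψ.continuous.integrable_of_hasCompactSupport hc
    have hm : AEStronglyMeasurable (fun x => fderiv ℝ w x (EuclideanSpace.single i 1)) :=
      (measurable_fderiv_apply_const ℝ w _).aestronglyMeasurable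
    refine (hI.norm.const_mul C).mono' (hm.mul hI.aestronglyMeasurable)
      (Eventually.of_forall fun x => ?_)
    rw [norm_mul]
    by_cases hx : x ∈ tsupport ψ
    · exact mul_le_mul_of_nonneg_right ((abs_partialDeriv_le i w x).trans (hC x (hr hx)))
        (norm_nonneg _)
    · rw [image_eq_zero_of_notMem_tsupport hx]
      simp
  · exact (hw.continuous.mul (continuous_partialDeriv hψ i)).integrable_of_hasCompactSupport
      (hasCompactSupport_partialDeriv hc i).mul_left
  · exact (hw.continuous.mul hψ.continuous).integrable_of_hasCompactSupport hc.mul_left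

theorem exists_norm_fderiv_le_of_contDiff {E F : Type*} [NormedAddCommGroup E] [NormedSpace ℝ E]
    [ProperSpace E] [NormedAddCommGroup F] [NormedSpace ℝ F] {w : E → F} (hw : ContDiff ℝ 1 w)
    (r : ℝ) : ∃ C, ∀ x ∈ Metric.ball (0 : E) r, ‖fderiv ℝ w x‖ ≤ C := by
  obtain ⟨C, hC⟩ := (isCompact_closedBall (0 : E) r).exists_bound_of_continuousOn
    (hw.continuous_fderiv one_ne_zero).continuousOn
  exact ⟨C, fun x hx => hC x (Metric.ball_subset_closedBall hx)⟩

theorem testFunctions.contDiff_one {D : Set Plane} {ψ : Plane → ℝ} (h : ψ ∈ testFunctions D) :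
    ContDiff ℝ 1 ψ := h.1.of_le (by exact_mod_cast le_top)

theorem hasWeakGradient_of_mem_testFunctions {D : Set Plane} {ψ : Plane → ℝ}
    (h : ψ ∈ testFunctions D) : HasWeakGradient D ψ (gradient ψ) := by
  intro θ hθ i
  have h1 : ∀ x, x ∉ D → ψ x = 0 := fun x hx =>
    image_eq_zero_of_notMem_tsupport fun hx' => hx (h.2.2 hx')
  have h2 : ∀ x, x ∉ D → θ x = 0 := fun x hx =>
    image_eq_zero_of_notMem_tsupport fun hx' => hx (hθ.2.2 hx')
  rw [setIntegral_eq_integral_of_forall_compl_eq_zero (fun x hx => by rw [h1 x hx, zero_mul]),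
    setIntegral_eq_integral_of_forall_compl_eq_zero (fun x hx => by rw [h2 x hx, mul_zero])]
  simp_rw [gradient_apply]
  have hψ1 := testFunctions.contDiff_one h
  exact integral_mul_partialDeriv (hψ1.differentiable one_ne_zero)
    (exists_norm_fderiv_le_of_contDiff hψ1) (testFunctions.contDiff_one hθ) hθ.2.1 i

/-! ### The graph of the gradient in `Lᵖ × Lᵖ` -/

/-- On a finite measure space convergence in `L^q` implies convergence in `L¹`, and a bounded factor
preserves it. This passes integration by parts to the limit. -/
theorem tendsto_integral_mul_of_eLpNorm {α : Type*} [MeasurableSpace α] {μ : Measure α}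
    [IsFiniteMeasure μ] {q : ℝ≥0∞} (hq : 1 ≤ q) {v : ℕ → α → ℝ} {v₀ g : α → ℝ}
    (hv : ∀ n, MemLp (v n) q μ) (hv₀ : MemLp v₀ q μ) (hg : AEStronglyMeasurable g μ) {C : ℝ}
    (hgC : ∀ x, ‖g x‖ ≤ C) (h : Tendsto (fun n => eLpNorm (v n - v₀) q μ) atTop (𝓝 0)) :
    Tendsto (fun n => ∫ x, v n x * g x ∂μ) atTop (𝓝 (∫ x, v₀ x * g x ∂μ)) := by
  have hint : ∀ {w : α → ℝ}, MemLp w q μ → Integrable (fun x => w x * g x) μ := fun hw =>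
    (hw.integrable hq).mul_bdd hg (Eventually.of_forall hgC)
  refine tendsto_integral_of_L1' _ (hint hv₀).aestronglyMeasurable
    (Eventually.of_forall fun n => hint (hv n)) ?_
  have hbound : ∀ n, eLpNorm ((fun x => v n x * g x) - fun x => v₀ x * g x) 1 μ
      ≤ ENNReal.ofReal C * (eLpNorm (v n - v₀) q μ *
        μ Set.univ ^ (1 / (1 : ℝ≥0∞).toReal - 1 / q.toReal)) := by
    intro n
    refine (eLpNorm_le_mul_eLpNorm_of_ae_le_mul (g := v n - v₀) (c := C)
      (Eventually.of_forall fun x => ?_) 1).trans ?_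
    · simp only [Pi.sub_apply, ← sub_mul]
      rw [norm_mul, mul_comm]
      exact mul_le_mul_of_nonneg_right (hgC x) (norm_nonneg _)
    · gcongr
      exact eLpNorm_le_eLpNorm_mul_rpow_measure_univ hq
        ((hv n).aestronglyMeasurable.sub hv₀.aestronglyMeasurable)
  refine tendsto_of_tendsto_of_tendsto_of_le_of_le tendsto_const_nhds ?_ (fun _ => zero_le)
    hbound
  have hfin : μ Set.univ ^ (1 / (1 : ℝ≥0∞).toReal - 1 / q.toReal) ≠ ⊤ := by
    refine ENNReal.rpow_ne_top_of_nonneg ?_ (measure_ne_top _ _)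
    rcases eq_or_ne q ⊤ with rfl | hqt
    · simp
    · have : 1 ≤ q.toReal := by
        rw [← ENNReal.toReal_one]
        exact ENNReal.toReal_mono hqt hq
      rw [ENNReal.toReal_one, div_one, sub_nonneg]
      exact div_le_one_of_le₀ this (by linarith)
  have h1 := ENNReal.Tendsto.const_mul (a := ENNReal.ofReal C)
    (ENNReal.Tendsto.mul_const h (Or.inr hfin)) (Or.inr ENNReal.ofReal_ne_top)
  simpa using h1

theorem testFunctions_add {D : Set Plane} {ψ θ : Plane → ℝ} (hψ : ψ ∈ testFunctions D)
    (hθ : θ ∈ testFunctions D) (a b : ℝ) : (fun x => a * ψ x + b * θ x) ∈ testFunctions D := by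
  refine ⟨(contDiff_const.mul hψ.1).add (contDiff_const.mul hθ.1),
    hψ.2.1.mul_left.add hθ.2.1.mul_left, ?_⟩
  have h1 : tsupport (fun x => a * ψ x + b * θ x) ⊆ tsupport ψ ∪ tsupport θ := by
    refine closure_minimal (fun x hx => ?_)
      ((isClosed_tsupport _).union (isClosed_tsupport _))
    by_contra hcon
    rw [mem_union, not_or] at hcon
    exact hx (by simp [image_eq_zero_of_notMem_tsupport hcon.1,
      image_eq_zero_of_notMem_tsupport hcon.2])
  exact h1.trans (union_subset hψ.2.2 hθ.2.2)

/-- The pairs `(ψ, ∇ψ)` of the test functions `ψ` on `D`, in `Lᵠ × Lᵠ`. -/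
def testGraph (q : ℝ≥0∞) (D : Set Plane) :
    Set (Lp ℝ q (volume.restrict D) × Lp Plane q (volume.restrict D)) :=
  {z | ∃ ψ ∈ testFunctions D, z.1 =ᵐ[volume.restrict D] ψ ∧
    z.2 =ᵐ[volume.restrict D] gradient ψ}

theorem convex_testGraph (q : ℝ≥0∞) (D : Set Plane) : Convex ℝ (testGraph q D) := by
  rintro ⟨u, G⟩ ⟨ψ, hψ, hu, hG⟩ ⟨v, H⟩ ⟨θ, hθ, hv, hH⟩ a b - - -
  refine ⟨_, testFunctions_add hψ hθ a b, ?_, ?_⟩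
  · filter_upwards [hu, hv, Lp.coeFn_add (a • u) (b • v), Lp.coeFn_smul a u, Lp.coeFn_smul b v]
      with x h1 h2 h3 h4 h5
    simp only [Prod.smul_mk, Prod.mk_add_mk] at h1 h2 ⊢
    rw [h3, Pi.add_apply, h4, h5, Pi.smul_apply, Pi.smul_apply, h1, h2, smul_eq_mul, smul_eq_mul]
  · filter_upwards [hG, hH, Lp.coeFn_add (a • G) (b • H), Lp.coeFn_smul a G, Lp.coeFn_smul b H]
      with x h1 h2 h3 h4 h5
    simp only [Prod.smul_mk, Prod.mk_add_mk] at h1 h2 ⊢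
    rw [h3, Pi.add_apply, h4, h5, Pi.smul_apply, Pi.smul_apply, h1, h2]
    have hd1 := (testFunctions.contDiff_one hψ).differentiable one_ne_zero x
    have hd2 := (testFunctions.contDiff_one hθ).differentiable one_ne_zero x
    simp only [gradient]
    rw [fderiv_fun_add (hd1.const_mul a) (hd2.const_mul b), fderiv_const_mul hd1,
      fderiv_const_mul hd2, map_add, map_smulₛₗ, map_smulₛₗ]
    rfl

theorem memLp_testFunction {D : Set Plane} {ψ : Plane → ℝ} (h : ψ ∈ testFunctions D) (q : ℝ≥0∞) :
    MemLp ψ q (volume.restrict D) :=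
  (h.1.continuous.memLp_of_hasCompactSupport h.2.1).restrict _

theorem memLp_gradient_testFunction {D : Set Plane} {ψ : Plane → ℝ} (h : ψ ∈ testFunctions D)
    (q : ℝ≥0∞) : MemLp (gradient ψ) q (volume.restrict D) :=
  ((continuous_gradient (testFunctions.contDiff_one h)).memLp_of_hasCompactSupport
    (hasCompactSupport_gradient h.2.1)).restrict _

/-- With the converse below, this turns membership in `W₀^{1,p}` into membership in a closed convex
subset of `Lᵖ × Lᵖ`, the form required by the uniform convexity argument. -/
theorem IsW0WithGradient.mem_closure {p : ℝ} [Fact (1 ≤ ENNReal.ofReal p)] {D : Set Plane}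
    {u : Plane → ℝ} {G : Plane → Plane} (h : IsW0WithGradient p D u G) :
    (h.memLp.toLp u, h.memLp_gradient.toLp G) ∈ closure (testGraph (ENNReal.ofReal p) D) := by
  obtain ⟨ψ, hψ, h1, h2⟩ := h.approx
  refine mem_closure_of_tendsto (f := fun n => ((memLp_testFunction (hψ n) _).toLp (ψ n),
    (memLp_gradient_testFunction (hψ n) _).toLp (gradient (ψ n)))) (b := atTop) ?_ (Eventually.of_forall fun n =>
    ⟨ψ n, hψ n, (memLp_testFunction (hψ n) _).coeFn_toLp,
      (memLp_gradient_testFunction (hψ n) _).coeFn_toLp⟩)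
  exact ((Lp.tendsto_Lp_iff_tendsto_eLpNorm'' _ _ _ _).2 h1).prodMk_nhds
    ((Lp.tendsto_Lp_iff_tendsto_eLpNorm'' _ _ _ _).2 h2)

/-- A sequence of test functions converging in the graph norm is the approximation demanded by the
definition, and both sides of the integration by parts identity pass to the limit along it. -/
theorem isW0WithGradient_of_mem_closure {p : ℝ} [Fact (1 ≤ ENNReal.ofReal p)] {D : Set Plane}
    (hD : volume D ≠ ⊤)
    {z : Lp ℝ (ENNReal.ofReal p) (volume.restrict D) ×
      Lp Plane (ENNReal.ofReal p) (volume.restrict D)}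
    (hz : z ∈ closure (testGraph (ENNReal.ofReal p) D)) {u : Plane → ℝ}
    (hu : u =ᵐ[volume.restrict D] z.1) : IsW0WithGradient p D u z.2 := by
  have hfin : IsFiniteMeasure (volume.restrict D) :=
    ⟨by rw [Measure.restrict_apply_univ]; exact lt_top_iff_ne_top.2 hD⟩
  have hq : 1 ≤ ENNReal.ofReal p := Fact.out
  have huLp : MemLp u (ENNReal.ofReal p) (volume.restrict D) := (memLp_congr_ae hu).2 (Lp.memLp _)
  obtain ⟨w, hw, hwz⟩ := mem_closure_iff_seq_limit.1 hz
  choose ψ hψ h1 h2 using hw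
  have ht1 := (continuous_fst.tendsto z).comp hwz
  have ht2 := (continuous_snd.tendsto z).comp hwz
  have e1 : z.1 = (Lp.memLp z.1).toLp z.1 := (Lp.toLp_coeFn _ _).symm
  have e2 : z.2 = (Lp.memLp z.2).toLp z.2 := (Lp.toLp_coeFn _ _).symm
  rw [e1] at ht1
  rw [e2] at ht2
  have hl1 := (Lp.tendsto_Lp_iff_tendsto_eLpNorm _ _ _).1 ht1
  have hl2 := (Lp.tendsto_Lp_iff_tendsto_eLpNorm _ _ _).1 ht2
  have hL1 : Tendsto (fun n => eLpNorm (fun x => ψ n x - u x) (ENNReal.ofReal p)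
      (volume.restrict D)) atTop (𝓝 0) := by
    refine hl1.congr fun n => eLpNorm_congr_ae ?_
    filter_upwards [h1 n, hu] with x hx hx'
    simp only [Function.comp, Pi.sub_apply]
    rw [hx, hx']
  have hL2 : Tendsto (fun n => eLpNorm (fun x => gradient (ψ n) x - z.2 x) (ENNReal.ofReal p)
      (volume.restrict D)) atTop (𝓝 0) := by
    refine hl2.congr fun n => eLpNorm_congr_ae ?_
    filter_upwards [h2 n] with x hx
    simp only [Function.comp, Pi.sub_apply]
    rw [hx]
  refine ⟨huLp, Lp.memLp _, fun θ hθ i => ?_, ψ, hψ, hL1, hL2⟩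
  have hθ1 := testFunctions.contDiff_one hθ
  obtain ⟨C₁, hC₁⟩ := hθ1.continuous.bounded_above_of_compact_support hθ.2.1
  obtain ⟨C₂, hC₂⟩ := (continuous_partialDeriv hθ1 i).bounded_above_of_compact_support
    (hasCompactSupport_partialDeriv hθ.2.1 i)
  have hcomp : ∀ {g : Plane → Plane}, MemLp g (ENNReal.ofReal p) (volume.restrict D) →
      MemLp (fun x => g x i) (ENNReal.ofReal p) (volume.restrict D) := fun hg =>
    (EuclideanSpace.proj (𝕜 := ℝ) i).comp_memLp' hg
  have A := tendsto_integral_mul_of_eLpNorm hq (fun n => memLp_testFunction (hψ n) _) huLp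
    (continuous_partialDeriv hθ1 i).aestronglyMeasurable hC₂ hL1
  have B := tendsto_integral_mul_of_eLpNorm hq
    (fun n => hcomp (memLp_gradient_testFunction (hψ n) _))
    (hcomp (Lp.memLp z.2)) hθ1.continuous.aestronglyMeasurable hC₁
    (tendsto_of_tendsto_of_tendsto_of_le_of_le tendsto_const_nhds hL2 (fun _ => zero_le)
      fun n => eLpNorm_mono fun x => by
        simpa using PiLp.norm_apply_le (gradient (ψ n) x - z.2 x) i)
  refine tendsto_nhds_unique A ?_
  refine B.neg.congr fun n => ?_
  exact (hasWeakGradient_of_mem_testFunctions (hψ n) θ hθ i).symm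

/-! ### Lower semicontinuity of the Modica–Mortola functional -/

/-- Lower semicontinuity is closedness of the sublevel sets, which may be tested on sequences; the
level `⊤` is trivial. -/
theorem lowerSemicontinuous_of_seq {X : Type*} [TopologicalSpace X] [SequentialSpace X]
    {F : X → ℝ≥0∞} (h : ∀ (u : ℕ → X) (u₀ : X) (y : ℝ≥0∞), y ≠ ⊤ → Tendsto u atTop (𝓝 u₀) →
      (∀ n, F (u n) ≤ y) → F u₀ ≤ y) : LowerSemicontinuous F := by
  refine lowerSemicontinuous_iff_isClosed_preimage.2 fun y => IsSeqClosed.isClosed ?_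
  intro u u₀ hu hlim
  rcases eq_or_ne y ⊤ with rfl | hy
  · exact mem_preimage.2 (mem_Iic.2 le_top)
  · exact h u u₀ y hy hlim hu

theorem lowerSemicontinuous_ofReal_mul {X : Type*} [TopologicalSpace X] {F : X → ℝ≥0∞} (a : ℝ)
    (hF : LowerSemicontinuous F) : LowerSemicontinuous fun u => ENNReal.ofReal a * F u :=
  Continuous.comp_lowerSemicontinuous (ENNReal.continuous_const_mul ENNReal.ofReal_ne_top) hF
    (fun _ _ h => mul_le_mul_right h _)

/-! ### Phase fields under `L¹` convergence. -/

theorem phaseFields_exists_subseq_ae {R : ℝ} {u : ℕ → phaseFields R} {u₀ : phaseFields R}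
    (h : Tendsto u atTop (𝓝 u₀)) : ∃ ns : ℕ → ℕ, StrictMono ns ∧
      ∀ᵐ x ∂(volume : Measure Plane),
        Tendsto (fun k => (u (ns k)).1 x) atTop (𝓝 (u₀.1 x)) := by
  have h1 : Tendsto (fun n => (u n).1) atTop (𝓝 u₀.1) := (continuous_subtype_val.tendsto _).comp h
  exact (tendstoInMeasure_of_tendsto_Lp h1).exists_seq_tendsto_ae

theorem phaseFields_tendsto_eLpNorm_one {R : ℝ} {u : ℕ → phaseFields R} {u₀ : phaseFields R}
    (h : Tendsto u atTop (𝓝 u₀)) :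
    Tendsto (fun n => ∫⁻ x, ‖(u n).1 x - u₀.1 x‖ₑ) atTop (𝓝 0) := by
  have h1 : Tendsto (fun n => (u n).1) atTop (𝓝 u₀.1) := (continuous_subtype_val.tendsto _).comp h
  rw [← Lp.toLp_coeFn u₀.1 (Lp.memLp _)] at h1
  have h2 := (Lp.tendsto_Lp_iff_tendsto_eLpNorm _ _ _).1 h1
  simpa [eLpNorm_one_eq_lintegral_enorm] using h2

theorem lintegral_comp_le_of_tendsto {R : ℝ} {g : ℝ → ℝ≥0∞} (hg : Continuous g) (D : Set Plane)
    {u : ℕ → phaseFields R} {u₀ : phaseFields R} (h : Tendsto u atTop (𝓝 u₀)) {y : ℝ≥0∞}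
    (hy : ∀ n, ∫⁻ x in D, g ((u n).1 x) ≤ y) : ∫⁻ x in D, g (u₀.1 x) ≤ y := by
  obtain ⟨ns, -, hns⟩ := phaseFields_exists_subseq_ae h
  calc ∫⁻ x in D, g (u₀.1 x) = ∫⁻ x in D, liminf (fun k => g ((u (ns k)).1 x)) atTop := by
        refine lintegral_congr_ae (ae_restrict_of_ae ?_)
        filter_upwards [hns] with x hx
        exact ((hg.tendsto _).comp hx).liminf_eq.symm
    _ ≤ liminf (fun k => ∫⁻ x in D, g ((u (ns k)).1 x)) atTop := by
        refine lintegral_liminf_le' fun k => ?_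
        exact hg.measurable.comp_aemeasurable
          (Lp.aestronglyMeasurable (u (ns k)).1).aemeasurable.restrict
    _ ≤ y := by
        refine liminf_le_of_frequently_le' (Frequently.of_forall fun k => hy _)

theorem phaseFields_abs_sub_le {R : ℝ} (u v : phaseFields R) :
    ∀ᵐ x ∂(volume : Measure Plane), ‖u.1 x - v.1 x‖ ≤ 1 := by
  filter_upwards [u.2.1, v.2.1] with x h1 h2
  rw [Real.norm_eq_abs, abs_le]
  constructor <;> linarith

theorem phaseFields_memLp {R : ℝ} (u : phaseFields R) (q : ℝ≥0∞) :
    MemLp u.1 q (volume.restrict (Metric.ball (0 : Plane) R)) := by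
  have : IsFiniteMeasure (volume.restrict (Metric.ball (0 : Plane) R)) :=
    ⟨by rw [Measure.restrict_apply_univ]; exact measure_ball_lt_top⟩
  refine MemLp.of_bound (Lp.aestronglyMeasurable u.1).restrict 1 (ae_restrict_of_ae ?_)
  filter_upwards [u.2.1] with x hx
  rw [Real.norm_eq_abs, abs_le]
  constructor <;> linarith

/-- Differences of phase fields are bounded by `1`, so their `p`-th powers are dominated by their
absolute values and `L¹` convergence upgrades to `Lᵖ`. -/
theorem phaseFields_tendsto_eLpNorm {R : ℝ} {p : ℝ} (hp : 1 < p) {u : ℕ → phaseFields R}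
    {u₀ : phaseFields R} (h : Tendsto u atTop (𝓝 u₀)) (D : Set Plane) :
    Tendsto (fun n => eLpNorm ((u n).1 - u₀.1 : Plane → ℝ) (ENNReal.ofReal p) (volume.restrict D))
      atTop (𝓝 0) := by
  have hp0 : 0 < p := by linarith
  have h1 := phaseFields_tendsto_eLpNorm_one h
  have h2 : Tendsto (fun n => (∫⁻ x, ‖(u n).1 x - u₀.1 x‖ₑ) ^ (1 / p)) atTop (𝓝 0) := by
    have := h1.ennrpow_const (1 / p)
    rwa [ENNReal.zero_rpow_of_pos (by positivity)] at this
  refine tendsto_of_tendsto_of_tendsto_of_le_of_le tendsto_const_nhds h2 (fun _ => zero_le)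
    fun n => ?_
  dsimp only
  rw [eLpNorm_eq_lintegral_rpow_enorm_toReal (by simpa using hp0) ENNReal.ofReal_ne_top,
    ENNReal.toReal_ofReal hp0.le]
  refine ENNReal.rpow_le_rpow ?_ (by positivity)
  refine (lintegral_mono' Measure.restrict_le_self le_rfl).trans (lintegral_mono_ae ?_)
  filter_upwards [phaseFields_abs_sub_le (u n) u₀] with x hx
  have hx1 : ‖(u n).1 x - u₀.1 x‖ₑ ≤ 1 := by
    rw [← ofReal_norm]
    exact ENNReal.ofReal_le_one.2 hx
  calc ‖(u n).1 x - u₀.1 x‖ₑ ^ p ≤ ‖(u n).1 x - u₀.1 x‖ₑ ^ (1 : ℝ) :=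
        ENNReal.rpow_le_rpow_of_exponent_ge hx1 hp.le
    _ = _ := ENNReal.rpow_one _

/-- The Dirichlet `p`-energy `∫_{B_R} ‖∇u‖^p` on `W₀^{1,p}(B_R)`, and `+∞` elsewhere. -/
noncomputable def dirichletEnergy (p R : ℝ) (u : Plane → ℝ) : ℝ≥0∞ :=
  ⨅ (G : Plane → Plane) (_ : IsW0WithGradient p (Metric.ball 0 R) u G ∧
      ∀ᵐ x ∂(volume : Measure Plane), x ∉ Metric.ball (0 : Plane) R → u x = 0),
    ∫⁻ x in Metric.ball (0 : Plane) R, ENNReal.ofReal (‖G x‖ ^ p)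

/-- The potential does not involve the gradient and leaves the infimum, so the two terms can be
treated by different methods, Fatou and convexity. -/
theorem modicaMortola_eq {p : ℝ} {W : ℝ → ℝ} (R : ℝ) {ε : ℝ}
    (hc : 0 < wellConst p W * ε ^ (p - 1) / p) (u : Plane → ℝ) :
    modicaMortola p W R ε u = ENNReal.ofReal (wellConst p W / (Real.conjExponent p * ε)) *
        (∫⁻ x in Metric.ball (0 : Plane) R, ENNReal.ofReal (W (u x))) +
      ENNReal.ofReal (wellConst p W * ε ^ (p - 1) / p) * dirichletEnergy p R u := by
  have h0 : ENNReal.ofReal (wellConst p W * ε ^ (p - 1) / p) ≠ 0 := by simpa using hc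
  simp only [dirichletEnergy, modicaMortola, ENNReal.mul_iInf_of_ne h0 ENNReal.ofReal_ne_top,
    ENNReal.add_iInf]

theorem ofReal_norm_rpow_eq_lintegral {α E : Type*} [MeasurableSpace α] [NormedAddCommGroup E]
    {μ : Measure α} {p : ℝ} (hp : 1 < p) (f : Lp E (ENNReal.ofReal p) μ) :
    ∫⁻ x, ENNReal.ofReal (‖f x‖ ^ p) ∂μ = ENNReal.ofReal (‖f‖ ^ p) := by
  rw [norm_rpow_eq_integral hp, ofReal_integral_eq_lintegral_ofReal (integrable_norm_rpow_Lp hp f)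
    (Eventually.of_forall fun x => by positivity)]

theorem lowerSemicontinuous_dirichletEnergy {p : ℝ} (hp : 1 < p) (R : ℝ) :
    LowerSemicontinuous fun u : phaseFields R => dirichletEnergy p R u.1 := by
  have hp0 : 0 < p := by linarith
  have : Fact (1 ≤ ENNReal.ofReal p) := ⟨by
    rw [← ENNReal.ofReal_one]
    exact ENNReal.ofReal_le_ofReal hp.le⟩
  refine lowerSemicontinuous_of_seq fun u u₀ y hy hlim hle => ?_
  -- The slack `e` allows a gradient to be chosen below `y + e` in each infimum, so uniqueness of
  -- the weak gradient is not needed.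
  refine ENNReal.le_of_forall_pos_le_add fun e he _ => ?_
  have hM : y + e ≠ ⊤ := by simp [hy]
  set M : ℝ := (y + e).toReal with hMdef
  have hye : y < y + e := ENNReal.lt_add_right hy (by simpa using he.ne')
  have := uniformConvexSpace_Lp (E := Plane) (μ := volume.restrict (Metric.ball (0 : Plane) R)) hp
  obtain ⟨G, hG, hGM⟩ := exists_norm_le_of_seq_of_convex
    (convex_testGraph (ENNReal.ofReal p) (Metric.ball (0 : Plane) R)).closure isClosed_closure
    (x := fun n => (phaseFields_memLp (u n) (ENNReal.ofReal p)).toLp (u n).1)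
    (x₀ := (phaseFields_memLp u₀ (ENNReal.ofReal p)).toLp u₀.1) (M := M ^ (1 / p))
    ((Lp.tendsto_Lp_iff_tendsto_eLpNorm'' _ _ _ _).2 (phaseFields_tendsto_eLpNorm hp hlim _))
    (fun n => by
      have hlt := (hle n).trans_lt hye
      simp only [dirichletEnergy, iInf_lt_iff] at hlt
      obtain ⟨G, hG, hlt⟩ := hlt
      refine ⟨hG.1.memLp_gradient.toLp G, hG.1.mem_closure, ?_⟩
      have h1 : ENNReal.ofReal (‖hG.1.memLp_gradient.toLp G‖ ^ p) ≤ y + e := by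
        rw [← ofReal_norm_rpow_eq_lintegral hp]
        refine (lintegral_congr_ae ?_).trans_le hlt.le
        filter_upwards [hG.1.memLp_gradient.coeFn_toLp] with x hx
        rw [hx]
      rw [← ENNReal.ofReal_toReal hM, ENNReal.ofReal_le_ofReal_iff ENNReal.toReal_nonneg] at h1
      have h2 := Real.rpow_le_rpow (by positivity) h1 (show 0 ≤ 1 / p by positivity)
      rwa [← Real.rpow_mul (norm_nonneg _), mul_one_div_cancel hp0.ne', Real.rpow_one] at h2)
  have hW0 : IsW0WithGradient p (Metric.ball 0 R) u₀.1 G :=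
    isW0WithGradient_of_mem_closure measure_ball_lt_top.ne hG
      (phaseFields_memLp u₀ _).coeFn_toLp.symm
  have hcond : IsW0WithGradient p (Metric.ball 0 R) u₀.1 G ∧
      ∀ᵐ x ∂(volume : Measure Plane), x ∉ Metric.ball (0 : Plane) R → u₀.1 x = 0 := ⟨hW0, u₀.2.2⟩
  refine (iInf₂_le (f := fun (G : Plane → Plane) (_ : IsW0WithGradient p (Metric.ball 0 R) u₀.1 G ∧
      ∀ᵐ x ∂(volume : Measure Plane), x ∉ Metric.ball (0 : Plane) R → u₀.1 x = 0) =>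
      ∫⁻ x in Metric.ball (0 : Plane) R, ENNReal.ofReal (‖G x‖ ^ p)) G hcond).trans ?_
  rw [ofReal_norm_rpow_eq_lintegral hp, ← ENNReal.ofReal_toReal hM]
  refine ENNReal.ofReal_le_ofReal ?_
  have h2 := Real.rpow_le_rpow (norm_nonneg _) hGM hp0.le
  rwa [← Real.rpow_mul ENNReal.toReal_nonneg, one_div_mul_cancel hp0.ne', Real.rpow_one] at h2

theorem lowerSemicontinuous_modicaMortola {p : ℝ} (hp : 1 < p) {W : ℝ → ℝ} (hW : Continuous W)
    (hWc : 0 < wellConst p W) (R : ℝ) {ε : ℝ} (hε : 0 < ε) :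
    LowerSemicontinuous fun u : phaseFields R => modicaMortola p W R ε u.1 := by
  have hp0 : 0 < p := by linarith
  have hc : 0 < wellConst p W * ε ^ (p - 1) / p := by positivity
  simp_rw [modicaMortola_eq R hc]
  refine (lowerSemicontinuous_ofReal_mul _ ?_).add (lowerSemicontinuous_ofReal_mul _
    (lowerSemicontinuous_dirichletEnergy hp R))
  exact lowerSemicontinuous_of_seq fun u u₀ y _ hlim hle =>
    lintegral_comp_le_of_tendsto (ENNReal.continuous_ofReal.comp hW) _ hlim hle

/-! ### Compactness in `L¹` -/

section Translation

set_option linter.unusedSectionVars false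

variable {E : Type*} [NormedAddCommGroup E] [NormedSpace ℝ E] [FiniteDimensional ℝ E]
  [MeasurableSpace E] [BorelSpace E] (μ : Measure E) [μ.IsAddHaarMeasure]

/-- The mean value of `v` on the ball of radius `r` centred at `x`. -/
noncomputable def ballMean (r : ℝ) (v : E → ℝ) (x : E) : ℝ :=
  (μ.real (Metric.ball 0 r))⁻¹ * ∫ τ in Metric.ball 0 r, v (x + τ) ∂μ

/-- After a shift by `y` the difference of the two means is at most the `L¹` size of one translation
increment by `x - y`. -/
theorem abs_ballMean_sub_le {r : ℝ} {v : E → ℝ} (hv : Integrable v μ) {C : ℝ} (hC : 0 ≤ C)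
    (htr : ∀ τ, ∫⁻ x, ‖v (x + τ) - v x‖ₑ ∂μ ≤ ENNReal.ofReal (C * ‖τ‖)) (x y : E) :
    |ballMean μ r v x - ballMean μ r v y| ≤ (μ.real (Metric.ball 0 r))⁻¹ * (C * ‖x - y‖) := by
  have hx := hv.comp_add_left x
  have hy := hv.comp_add_left y
  rw [ballMean, ballMean, ← mul_sub, ← integral_sub hx.integrableOn hy.integrableOn, abs_mul,
    abs_of_nonneg (inv_nonneg.2 measureReal_nonneg)]
  refine mul_le_mul_of_nonneg_left ?_ (inv_nonneg.2 measureReal_nonneg)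
  rw [← ENNReal.ofReal_le_ofReal_iff (by positivity), ← Real.norm_eq_abs, ofReal_norm]
  refine (enorm_integral_le_lintegral_enorm _).trans ?_
  refine (lintegral_mono' Measure.restrict_le_self le_rfl).trans ?_
  refine (le_of_eq ?_).trans (htr (x - y))
  rw [← lintegral_add_left_eq_self (fun τ => ‖v (τ + (x - y)) - v τ‖ₑ) y]
  refine lintegral_congr fun τ => ?_
  rw [show y + τ + (x - y) = x + τ by abel]

theorem abs_ballMean_le {r : ℝ} {v : E → ℝ} (hv : Integrable v μ) (x : E) :
    |ballMean μ r v x| ≤ (μ.real (Metric.ball 0 r))⁻¹ * ∫ y, |v y| ∂μ := by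
  rw [ballMean, abs_mul, abs_of_nonneg (inv_nonneg.2 measureReal_nonneg)]
  refine mul_le_mul_of_nonneg_left ?_ (inv_nonneg.2 measureReal_nonneg)
  refine (abs_integral_le_integral_abs).trans ?_
  refine (setIntegral_le_integral (hv.comp_add_left x).abs
    (Eventually.of_forall fun _ => abs_nonneg _)).trans_eq ?_
  exact integral_add_left_eq_self (fun y => |v y|) x

/-- The error `v - ballMean` is an average of translation increments of length below `r`; Tonelli
exchanges the average with the integral in `x`. -/
theorem lintegral_sub_ballMean_le {r : ℝ} (hr : 0 < r) {v : E → ℝ} (hvm : Measurable v)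
    (hv : Integrable v μ) {C : ℝ} (hC : 0 ≤ C)
    (htr : ∀ τ, ∫⁻ x, ‖v (x + τ) - v x‖ₑ ∂μ ≤ ENNReal.ofReal (C * ‖τ‖)) :
    ∫⁻ x, ‖v x - ballMean μ r v x‖ₑ ∂μ ≤ ENNReal.ofReal (C * r) := by
  set m : ℝ := μ.real (Metric.ball 0 r) with hm
  have hm0 : 0 < m := ENNReal.toReal_pos (Metric.measure_ball_pos μ 0 hr).ne'
    measure_ball_lt_top.ne
  have hpt : ∀ x, ‖v x - ballMean μ r v x‖ₑ
      ≤ ENNReal.ofReal m⁻¹ * ∫⁻ τ in Metric.ball 0 r, ‖v (x + τ) - v x‖ₑ ∂μ := by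
    intro x
    have hx : IntegrableOn (fun τ => v (x + τ)) (Metric.ball 0 r) μ :=
      (hv.comp_add_left x).integrableOn
    have hcx : IntegrableOn (fun _ : E => v x) (Metric.ball 0 r) μ :=
      integrableOn_const measure_ball_lt_top.ne
    have : ballMean μ r v x - v x = m⁻¹ * ∫ τ in Metric.ball 0 r, (v (x + τ) - v x) ∂μ := by
      rw [integral_sub hx hcx, setIntegral_const, mul_sub, ballMean, ← hm, smul_eq_mul,
        inv_mul_cancel_left₀ hm0.ne']
    rw [enorm_sub_rev, this, enorm_mul, Real.enorm_of_nonneg (by positivity)]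
    gcongr
    exact enorm_integral_le_lintegral_enorm _
  have hmeas : Measurable (Function.uncurry fun x τ : E => ‖v (x + τ) - v x‖ₑ) :=
    ((hvm.comp (measurable_fst.add measurable_snd)).sub (hvm.comp measurable_fst)).enorm
  calc ∫⁻ x, ‖v x - ballMean μ r v x‖ₑ ∂μ
      ≤ ∫⁻ x, ENNReal.ofReal m⁻¹ * ∫⁻ τ in Metric.ball 0 r, ‖v (x + τ) - v x‖ₑ ∂μ ∂μ :=
        lintegral_mono hpt
    _ = ENNReal.ofReal m⁻¹ * ∫⁻ τ in Metric.ball 0 r, ∫⁻ x, ‖v (x + τ) - v x‖ₑ ∂μ ∂μ := by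
        rw [lintegral_const_mul' _ _ ENNReal.ofReal_ne_top,
          lintegral_lintegral_swap hmeas.aemeasurable]
    _ ≤ ENNReal.ofReal m⁻¹ * ∫⁻ _ in Metric.ball 0 r, ENNReal.ofReal (C * r) ∂μ := by
        refine mul_le_mul_right ?_ _
        refine setLIntegral_mono measurable_const fun τ hτ => (htr τ).trans ?_
        refine ENNReal.ofReal_le_ofReal (mul_le_mul_of_nonneg_left ?_ hC)
        exact (mem_ball_zero_iff.1 hτ).le
    _ = ENNReal.ofReal (C * r) := by
        rw [setLIntegral_const, ← ofReal_measureReal measure_ball_lt_top.ne, ← hm, mul_left_comm,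
          ← ENNReal.ofReal_mul (by positivity), inv_mul_cancel₀ hm0.ne', ENNReal.ofReal_one,
          mul_one]

/-- A discretization criterion: `S` is totally bounded if, at every scale, its points are
separated by a map with bounded range in a finite-dimensional space. -/
theorem totallyBounded_of_separating {X : Type*} [PseudoMetricSpace X] {S : Set X}
    (h : ∀ e > 0, ∃ (ι : Type) (_ : Fintype ι) (Φ : X → ι → ℝ) (B δ : ℝ), 0 < δ ∧
      (∀ x ∈ S, ∀ i, |Φ x i| ≤ B) ∧
      ∀ x ∈ S, ∀ y ∈ S, (∀ i, |Φ x i - Φ y i| ≤ δ) → dist x y < e) : TotallyBounded S := by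
  refine Metric.totallyBounded_of_finite_discretization fun e he => ?_
  obtain ⟨ι, _, Φ, B, δ, hδ, hB, hsep⟩ := h e he
  have hb : TotallyBounded (Φ '' S) := by
    refine ((isCompact_closedBall (0 : ι → ℝ) (max B 0)).totallyBounded).subset ?_
    rintro _ ⟨x, hx, rfl⟩
    rw [mem_closedBall_zero_iff, pi_norm_le_iff_of_nonneg (le_max_right _ _)]
    exact fun i => (hB x hx i).trans (le_max_left _ _)
  obtain ⟨t, ht, hcov⟩ := Metric.totallyBounded_iff.1 hb (δ / 2) (half_pos hδ)
  have hex : ∀ x : S, ∃ z : t, dist (Φ x) z < δ / 2 := by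
    intro x
    have := hcov ⟨x, x.2, rfl⟩
    simp only [mem_iUnion, Metric.mem_ball] at this
    obtain ⟨z, hz, hzd⟩ := this
    exact ⟨⟨z, hz⟩, hzd⟩
  choose F hF using hex
  have := ht.fintype
  refine ⟨ULift t, inferInstance, fun x => ⟨F x⟩, fun x y hxy => hsep x x.2 y y.2 fun i => ?_⟩
  have h1 := hF x
  have h2 := hF y
  rw [← ULift.up_injective hxy] at h2
  have h3 : dist (Φ x) (Φ y) < δ := (dist_triangle_right _ _ _).trans_lt (by linarith)
  exact (dist_le_pi_dist (Φ x) (Φ y) i).trans h3.le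

/-- A criterion of Kolmogorov–Riesz type: a bounded set of `L¹` functions supported in a fixed
ball, whose translations are Lipschitz in `L¹` with a uniform constant, is totally bounded. -/
theorem totallyBounded_of_translation {S : Set (Lp ℝ 1 μ)} {R M C : ℝ} (hC : 0 ≤ C)
    (hM : ∀ v ∈ S, ‖v‖ ≤ M) (hsupp : ∀ v ∈ S, ∀ᵐ x ∂μ, x ∉ Metric.ball (0 : E) R → v x = 0)
    (htr : ∀ v ∈ S, ∀ τ, ∫⁻ x, ‖v (x + τ) - v x‖ₑ ∂μ ≤ ENNReal.ofReal (C * ‖τ‖)) :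
    TotallyBounded S := by
  refine totallyBounded_of_separating fun e he => ?_
  -- The error budget is `3 e / 4`: averaging at scale `r` costs `e / 8` for each of the two
  -- functions, and comparing the averages on the ball costs `e / 2`. In the latter, `ρ` controls
  -- the oscillation of the averages between net points and `δ` their difference at net points.
  -- Adding `1` to `C` and `A` avoids division by zero.
  set r : ℝ := e / (8 * (C + 1)) with hr
  have hr0 : 0 < r := by positivity
  set m : ℝ := μ.real (Metric.ball 0 r) with hm
  have hm0 : 0 < m := ENNReal.toReal_pos (Metric.measure_ball_pos μ 0 hr0).ne'
    measure_ball_lt_top.ne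
  set A : ℝ := μ.real (Metric.ball (0 : E) R) with hA
  have hA0 : 0 ≤ A := measureReal_nonneg
  set δ : ℝ := e / (4 * (A + 1)) with hδ
  set ρ : ℝ := e / (8 * (A + 1) * m⁻¹ * (C + 1)) with hρ
  have hρ0 : 0 < ρ := by positivity
  obtain ⟨t, ht, hcov⟩ := Metric.totallyBounded_iff.1
    ((isCompact_closedBall (0 : E) R).totallyBounded.subset Metric.ball_subset_closedBall) ρ hρ0
  have := ht.fintype
  obtain ⟨n, ⟨f⟩⟩ := Finite.exists_equiv_fin t
  -- The separating map records the ball means at the points of a finite `ρ`-net of the ball.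
  refine ⟨Fin n, inferInstance, fun v i => ballMean μ r v (f.symm i), m⁻¹ * M, δ, by positivity,
    fun v hv i => ?_, fun v hv w hw hvw => ?_⟩
  · refine (abs_ballMean_le μ (L1.integrable_coeFn v) _).trans ?_
    refine mul_le_mul_of_nonneg_left ?_ (by positivity)
    have := hM v hv
    rw [L1.norm_eq_integral_norm] at this
    exact this
  · have hK : ∀ x ∈ Metric.ball (0 : E) R, ‖ballMean μ r v x - ballMean μ r w x‖ₑ
        ≤ ENNReal.ofReal (e / (2 * (A + 1))) := by
      intro x hx
      have := hcov hx
      simp only [mem_iUnion, Metric.mem_ball] at this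
      obtain ⟨z, hz, hzd⟩ := this
      rw [← ofReal_norm]
      refine ENNReal.ofReal_le_ofReal ?_
      have h1 := abs_ballMean_sub_le μ (r := r) (L1.integrable_coeFn v) hC (htr v hv) x z
      have h2 := abs_ballMean_sub_le μ (r := r) (L1.integrable_coeFn w) hC (htr w hw) x z
      have h3 := hvw (f ⟨z, hz⟩)
      simp only [Equiv.symm_apply_apply] at h3
      have h4 : m⁻¹ * (C * ‖x - z‖) ≤ e / (8 * (A + 1)) := by
        rw [← dist_eq_norm]
        calc m⁻¹ * (C * dist x z) ≤ m⁻¹ * ((C + 1) * ρ) := by gcongr; linarith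
          _ = _ := by rw [hρ]; field_simp
      rw [← hm] at h1 h2
      rw [Real.norm_eq_abs]
      have h5 : e / (2 * (A + 1)) = e / (8 * (A + 1)) + e / (8 * (A + 1)) + δ := by
        rw [hδ]; field_simp; norm_num
      rw [h5]
      have h6 : ballMean μ r v x - ballMean μ r w x = (ballMean μ r v x - ballMean μ r v z)
        - (ballMean μ r w x - ballMean μ r w z) + (ballMean μ r v z - ballMean μ r w z) := by ring
      rw [h6]
      refine (abs_add_le _ _).trans (add_le_add ((abs_sub _ _).trans ?_) h3)
      exact add_le_add (h1.trans h4) (h2.trans h4)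
    have hCr : C * r ≤ e / 8 := by
      calc C * r ≤ (C + 1) * r := by gcongr; linarith
        _ = e / 8 := by rw [hr]; field_simp
    have hmv := (Lp.stronglyMeasurable v).measurable
    have hmw := (Lp.stronglyMeasurable w).measurable
    have hv1 := (lintegral_sub_ballMean_le μ hr0 hmv (L1.integrable_coeFn v) hC (htr v hv)).trans
      (ENNReal.ofReal_le_ofReal hCr)
    have hw1 := (lintegral_sub_ballMean_le μ hr0 hmw (L1.integrable_coeFn w) hC (htr w hw)).trans
      (ENNReal.ofReal_le_ofReal hCr)
    have hcont : ∀ u ∈ S, Continuous (ballMean μ r u) := fun u hu =>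
      (LipschitzWith.of_dist_le_mul (K := ⟨m⁻¹ * C, by positivity⟩) fun x y => by
        rw [Real.dist_eq, dist_eq_norm]
        refine (abs_ballMean_sub_le μ (L1.integrable_coeFn u) hC (htr u hu) x y).trans_eq ?_
        rw [← mul_assoc]; rfl).continuous
    have hdist : ENNReal.ofReal (dist v w) ≤ ENNReal.ofReal (3 * e / 4) := by
      rw [dist_eq_norm, L1.norm_eq_integral_norm, ofReal_integral_norm_eq_lintegral_enorm
        (L1.integrable_coeFn _)]
      calc ∫⁻ x, ‖(v - w : Lp ℝ 1 μ) x‖ₑ ∂μ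
          = ∫⁻ x in Metric.ball (0 : E) R, ‖v x - w x‖ₑ ∂μ := by
            rw [← lintegral_indicator measurableSet_ball]
            refine lintegral_congr_ae ?_
            filter_upwards [Lp.coeFn_sub v w, hsupp v hv, hsupp w hw] with x h1 h2 h3
            by_cases hx : x ∈ Metric.ball (0 : E) R
            · rw [indicator_of_mem hx, h1, Pi.sub_apply]
            · rw [indicator_of_notMem hx, h1, Pi.sub_apply, h2 hx, h3 hx]
              simp
        _ ≤ ∫⁻ x in Metric.ball (0 : E) R, (‖v x - ballMean μ r v x‖ₑ +
              ‖w x - ballMean μ r w x‖ₑ + ENNReal.ofReal (e / (2 * (A + 1)))) ∂μ := by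
            refine setLIntegral_mono' measurableSet_ball fun x hx => ?_
            have : v x - w x = (v x - ballMean μ r v x) - (w x - ballMean μ r w x)
              + (ballMean μ r v x - ballMean μ r w x) := by ring
            rw [this]
            exact (enorm_add_le _ _).trans (add_le_add enorm_sub_le (hK x hx))
        _ ≤ ENNReal.ofReal (e / 8) + ENNReal.ofReal (e / 8) + ENNReal.ofReal (e / 2) := by
            rw [lintegral_add_right _ measurable_const, lintegral_add_left
              (show Measurable fun x => ‖v x - ballMean μ r v x‖ₑ from
                (hmv.sub (hcont v hv).measurable).enorm)]
            refine add_le_add (add_le_add ?_ ?_) ?_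
            · exact (lintegral_mono' Measure.restrict_le_self le_rfl).trans hv1
            · exact (lintegral_mono' Measure.restrict_le_self le_rfl).trans hw1
            · rw [setLIntegral_const, ← ofReal_measureReal measure_ball_lt_top.ne, ← hA,
                ← ENNReal.ofReal_mul (by positivity)]
              refine ENNReal.ofReal_le_ofReal ?_
              rw [div_mul_eq_mul_div, div_le_div_iff₀ (by positivity) (by norm_num)]
              nlinarith
        _ = ENNReal.ofReal (3 * e / 4) := by
            rw [← ENNReal.ofReal_add (by positivity) (by positivity),
              ← ENNReal.ofReal_add (by positivity) (by positivity)]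
            congr 1; ring
    rw [ENNReal.ofReal_le_ofReal_iff (by positivity)] at hdist
    linarith

end Translation

/-- The phase fields whose profile `Ψ ∘ u` has translations that are `C`-Lipschitz in `L¹`. -/
def translationBounded (Ψ : ℝ → ℝ) (R C : ℝ) : Set (phaseFields R) :=
  {u | ∀ τ : Plane, ∫⁻ x, ‖Ψ (u.1 (x + τ)) - Ψ (u.1 x)‖ₑ ≤ ENNReal.ofReal (C * ‖τ‖)}

theorem ae_comp_add_right {q : Plane → Prop} (h : ∀ᵐ x ∂(volume : Measure Plane), q x)
    (τ : Plane) : ∀ᵐ x ∂(volume : Measure Plane), q (x + τ) :=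
  (measurePreserving_add_right volume τ).quasiMeasurePreserving.ae h

/-- An injective continuous map on a compact interval is a closed embedding, and Tietze extends its
inverse to all of `ℝ`. The extension can thus be applied to limits of `Ψ ∘ u` without locating their
values. -/
theorem exists_continuous_leftInverse {Ψ : ℝ → ℝ} (hΨ : Continuous Ψ)
    (hmono : StrictMonoOn Ψ (Icc 0 1)) :
    ∃ g : ℝ → ℝ, Continuous g ∧ ∀ t ∈ Icc (0 : ℝ) 1, g (Ψ t) = t := by
  have he : IsClosedEmbedding ((Icc (0 : ℝ) 1).domRestrict Ψ) :=
    (hΨ.comp continuous_subtype_val).isClosedEmbedding hmono.injOn.injective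
  obtain ⟨g, hg⟩ := ContinuousMap.exists_extension he
    (⟨Subtype.val, continuous_subtype_val⟩ : C(Icc (0 : ℝ) 1, ℝ))
  refine ⟨g, g.continuous, fun t ht => ?_⟩
  exact DFunLike.congr_fun hg ⟨t, ht⟩

theorem phaseFields_norm_le {R : ℝ} (u : phaseFields R) :
    ‖u.1‖ ≤ volume.real (Metric.ball (0 : Plane) R) := by
  rw [L1.norm_eq_integral_norm, ← ENNReal.ofReal_le_ofReal_iff measureReal_nonneg,
    ofReal_integral_norm_eq_lintegral_enorm (L1.integrable_coeFn _),
    ofReal_measureReal measure_ball_lt_top.ne]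
  rw [← lintegral_indicator_one measurableSet_ball]
  refine lintegral_mono_ae ?_
  filter_upwards [u.2.1, u.2.2] with x h1 h2
  by_cases hx : x ∈ Metric.ball (0 : Plane) R
  · rw [indicator_of_mem hx, Pi.one_apply, Real.enorm_of_nonneg h1.1]
    exact ENNReal.ofReal_le_one.2 h1.2
  · rw [h2 hx]; simp

/-- The pointwise constraints survive almost everywhere limits, and the indicator of the ball
dominates, so dominated convergence gives `L¹` convergence. -/
theorem exists_phaseFields_of_ae_tendsto {R : ℝ} {u : ℕ → phaseFields R} {w : Plane → ℝ}
    (h : ∀ᵐ x ∂(volume : Measure Plane), Tendsto (fun n => (u n).1 x) atTop (𝓝 (w x))) :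
    ∃ u₀ : phaseFields R, u₀.1 =ᵐ[volume] w ∧ Tendsto u atTop (𝓝 u₀) := by
  have hall : ∀ᵐ x ∂(volume : Measure Plane), ∀ n, (0 ≤ (u n).1 x ∧ (u n).1 x ≤ 1) ∧
      (x ∉ Metric.ball (0 : Plane) R → (u n).1 x = 0) :=
    ae_all_iff.2 fun n => (u n).2.1.and (u n).2.2
  have hw01 : ∀ᵐ x ∂(volume : Measure Plane), 0 ≤ w x ∧ w x ≤ 1 := by
    filter_upwards [h, hall] with x h1 h2
    exact ⟨ge_of_tendsto' h1 fun n => (h2 n).1.1, le_of_tendsto' h1 fun n => (h2 n).1.2⟩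
  have hw0 : ∀ᵐ x ∂(volume : Measure Plane), x ∉ Metric.ball (0 : Plane) R → w x = 0 := by
    filter_upwards [h, hall] with x h1 h2 hx
    refine tendsto_nhds_unique h1 ?_
    simp_rw [(h2 _).2 hx]
    exact tendsto_const_nhds
  have hwm : AEStronglyMeasurable w volume :=
    aestronglyMeasurable_of_tendsto_ae atTop (fun n => Lp.aestronglyMeasurable (u n).1) h
  have hbd : Integrable ((Metric.ball (0 : Plane) R).indicator fun _ => (1 : ℝ)) :=
    (integrable_indicator_iff measurableSet_ball).2 (integrableOn_const measure_ball_lt_top.ne)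
  have hwi : Integrable w := by
    refine hbd.mono' hwm ?_
    filter_upwards [hw01, hw0] with x h1 h2
    by_cases hx : x ∈ Metric.ball (0 : Plane) R
    · rw [indicator_of_mem hx, Real.norm_of_nonneg h1.1]; exact h1.2
    · rw [indicator_of_notMem hx, h2 hx, norm_zero]
  have hwL : MemLp w 1 volume := memLp_one_iff_integrable.2 hwi
  have hcoe := hwL.coeFn_toLp
  refine ⟨⟨hwL.toLp w, ?_, ?_⟩, hcoe, ?_⟩
  · filter_upwards [hcoe, hw01] with x h1 h2
    rwa [h1]
  · filter_upwards [hcoe, hw0] with x h1 h2 hx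
    rw [h1, h2 hx]
  · rw [tendsto_subtype_rng]
    refine (Lp.tendsto_Lp_iff_tendsto_eLpNorm _ _ hwL).2 ?_
    simp_rw [eLpNorm_one_eq_lintegral_enorm]
    have hz : (0 : ℝ≥0∞) = ∫⁻ _ : Plane, 0 := by simp
    rw [hz]
    refine tendsto_lintegral_of_dominated_convergence'
      ((Metric.ball (0 : Plane) R).indicator fun _ => (1 : ℝ≥0∞)) (fun n => ?_) (fun n => ?_) ?_ ?_
    · exact ((Lp.aestronglyMeasurable (u n).1).sub hwm).enorm
    · filter_upwards [hall, hw01, hw0] with x h1 h2 h3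
      simp only [Pi.sub_apply]
      by_cases hx : x ∈ Metric.ball (0 : Plane) R
      · rw [indicator_of_mem hx, ← ofReal_norm]
        refine ENNReal.ofReal_le_one.2 ?_
        rw [Real.norm_eq_abs, abs_le]
        have := (h1 n).1
        constructor <;> linarith
      · rw [(h1 n).2 hx, h3 hx]; simp
    · rw [lintegral_indicator measurableSet_ball, setLIntegral_const, one_mul]
      exact measure_ball_lt_top.ne
    · filter_upwards [h] with x hx
      have : Tendsto (fun n => (u n).1 x - w x) atTop (𝓝 0) := by
        simpa using hx.sub_const (w x)
      simpa using this.enorm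

theorem mem_translationBounded_of_tendsto {Ψ : ℝ → ℝ} (hΨ : Continuous Ψ) {R C : ℝ}
    {u : ℕ → phaseFields R} {u₀ : phaseFields R} (hu : ∀ n, u n ∈ translationBounded Ψ R C)
    (h : Tendsto u atTop (𝓝 u₀)) : u₀ ∈ translationBounded Ψ R C := by
  intro τ
  obtain ⟨ns, -, hns⟩ := phaseFields_exists_subseq_ae h
  calc ∫⁻ x, ‖Ψ (u₀.1 (x + τ)) - Ψ (u₀.1 x)‖ₑ
      = ∫⁻ x, liminf (fun k => ‖Ψ ((u (ns k)).1 (x + τ)) - Ψ ((u (ns k)).1 x)‖ₑ) atTop := by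
        refine lintegral_congr_ae ?_
        filter_upwards [hns, ae_comp_add_right hns τ] with x h1 h2
        exact (((hΨ.tendsto _).comp h2).sub ((hΨ.tendsto _).comp h1)).enorm.liminf_eq.symm
    _ ≤ liminf (fun k => ∫⁻ x, ‖Ψ ((u (ns k)).1 (x + τ)) - Ψ ((u (ns k)).1 x)‖ₑ) atTop := by
        refine lintegral_liminf_le' fun k => ?_
        have hm : Measurable (u (ns k)).1 := (Lp.stronglyMeasurable _).measurable
        exact (((hΨ.measurable.comp (hm.comp (measurable_add_const τ))).sub
          (hΨ.measurable.comp hm)).enorm).aemeasurable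
    _ ≤ ENNReal.ofReal (C * ‖τ‖) :=
        liminf_le_of_frequently_le' (Frequently.of_forall fun k => hu _ τ)

/-- The translation criterion makes the functions `Ψ ∘ u` precompact in `L¹`. An almost everywhere
convergent subsequence is pulled back by the continuous left inverse of `Ψ`, and the limit keeps the
translation bound by Fatou. -/
theorem isCompact_translationBounded {Ψ : ℝ → ℝ} {L : ℝ≥0} (hΨ : LipschitzWith L Ψ)
    (hΨ0 : Ψ 0 = 0) (hmono : StrictMonoOn Ψ (Icc 0 1)) (R : ℝ) {C : ℝ} (hC : 0 ≤ C) :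
    IsCompact (translationBounded Ψ R C) := by
  refine IsSeqCompact.isCompact fun u hu => ?_
  let v : ℕ → Lp ℝ 1 (volume : Measure Plane) := fun n => hΨ.compLp hΨ0 (u n).1
  have hv : ∀ n, v n =ᵐ[volume] fun x => Ψ ((u n).1 x) := fun n => hΨ.coeFn_compLp hΨ0 (u n).1
  have htb : TotallyBounded (range v) := by
    refine totallyBounded_of_translation volume (R := R) hC
      (M := L * volume.real (Metric.ball (0 : Plane) R)) ?_ ?_ ?_
    · rintro _ ⟨n, rfl⟩
      refine (hΨ.norm_compLp_le hΨ0 (u n).1).trans ?_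
      exact mul_le_mul_of_nonneg_left (phaseFields_norm_le _) L.2
    · rintro _ ⟨n, rfl⟩
      filter_upwards [hv n, (u n).2.2] with x h1 h2 hx
      rw [h1, h2 hx, hΨ0]
    · rintro _ ⟨n, rfl⟩ τ
      refine (le_of_eq (lintegral_congr_ae ?_)).trans (hu n τ)
      filter_upwards [hv n, ae_comp_add_right (hv n) τ] with x h1 h2
      rw [h1, h2]
  obtain ⟨v₀, -, ns, hns, hlim⟩ :=
    (htb.closure.isCompact_of_isClosed isClosed_closure).tendsto_subseq
      (fun n => subset_closure (mem_range_self n))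
  obtain ⟨ms, hms, hae⟩ := (tendstoInMeasure_of_tendsto_Lp hlim).exists_seq_tendsto_ae
  obtain ⟨g, hg, hgΨ⟩ := exists_continuous_leftInverse hΨ.continuous hmono
  obtain ⟨u₀, -, hu₀⟩ := exists_phaseFields_of_ae_tendsto (u := fun k => u (ns (ms k)))
    (w := fun x => g (v₀ x)) (by
      filter_upwards [hae, ae_all_iff.2 hv, ae_all_iff.2 fun n => (u n).2.1] with x h1 h2 h3
      refine ((hg.tendsto _).comp h1).congr fun k => ?_
      simp only [Function.comp]
      rw [h2, hgΨ _ (h3 _)])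
  exact ⟨u₀, mem_translationBounded_of_tendsto hΨ.continuous (fun k => hu _) hu₀,
    fun k => ns (ms k), hns.comp hms, hu₀⟩

/-! ### The Modica–Mortola bound -/

/-- The fundamental theorem of calculus along the segment from `x` to `x + τ`, then Tonelli and
translation invariance. -/
theorem lintegral_translation_le {w : Plane → ℝ} (hw : ContDiff ℝ 1 w) (τ : Plane) :
    ∫⁻ x, ‖w (x + τ) - w x‖ₑ ≤ (∫⁻ x, ‖fderiv ℝ w x‖ₑ) * ‖τ‖ₑ := by
  have hdc : Continuous (fderiv ℝ w) := hw.continuous_fderiv one_ne_zero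
  have hpt : ∀ x, ‖w (x + τ) - w x‖ₑ
      ≤ ∫⁻ t in Ioc (0 : ℝ) 1, ‖fderiv ℝ w (x + t • τ)‖ₑ * ‖τ‖ₑ := by
    intro x
    have hderiv : ∀ t ∈ uIcc (0 : ℝ) 1,
        HasDerivAt (fun t : ℝ => w (x + t • τ)) (fderiv ℝ w (x + t • τ) τ) t := by
      intro t _
      have h1 : HasDerivAt (fun t : ℝ => x + t • τ) τ t := by
        simpa using ((hasDerivAt_id t).smul_const τ).const_add x
      exact (hw.differentiable one_ne_zero _).hasFDerivAt.comp_hasDerivAt t h1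
    have hci : Continuous fun t : ℝ => fderiv ℝ w (x + t • τ) τ :=
      (hdc.comp (by fun_prop)).clm_apply continuous_const
    have hint := intervalIntegral.integral_eq_sub_of_hasDerivAt hderiv
      (hci.intervalIntegrable 0 1)
    rw [zero_smul, one_smul, add_zero] at hint
    rw [← hint, intervalIntegral.integral_of_le zero_le_one]
    refine (enorm_integral_le_lintegral_enorm _).trans (lintegral_mono fun t => ?_)
    exact (fderiv ℝ w (x + t • τ)).le_opENorm τ
  have hmeas : Measurable (Function.uncurry fun (x : Plane) (t : ℝ) =>
      ‖fderiv ℝ w (x + t • τ)‖ₑ * ‖τ‖ₑ) := by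
    refine Continuous.measurable ?_
    refine ENNReal.continuous_mul_const enorm_ne_top |>.comp ?_
    exact (hdc.comp (by fun_prop)).enorm
  calc ∫⁻ x, ‖w (x + τ) - w x‖ₑ
      ≤ ∫⁻ x, ∫⁻ t in Ioc (0 : ℝ) 1, ‖fderiv ℝ w (x + t • τ)‖ₑ * ‖τ‖ₑ := lintegral_mono hpt
    _ = ∫⁻ t in Ioc (0 : ℝ) 1, ∫⁻ x, ‖fderiv ℝ w (x + t • τ)‖ₑ * ‖τ‖ₑ :=
        lintegral_lintegral_swap hmeas.aemeasurable
    _ = ∫⁻ t in Ioc (0 : ℝ) 1, (∫⁻ x, ‖fderiv ℝ w x‖ₑ) * ‖τ‖ₑ := by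
        refine lintegral_congr fun t => ?_
        rw [lintegral_mul_const' _ _ enorm_ne_top,
          lintegral_add_right_eq_self (fun x => ‖fderiv ℝ w x‖ₑ) (t • τ)]
    _ = (∫⁻ x, ‖fderiv ℝ w x‖ₑ) * ‖τ‖ₑ := by simp

/-- The truncated density `W(max 0 (min s 1))^{1/p'}`. -/
noncomputable def truncatedDensity (p : ℝ) (W : ℝ → ℝ) (s : ℝ) : ℝ :=
  W (max 0 (min s 1)) ^ (1 / Real.conjExponent p)

/-- The Modica–Mortola profile `c_p ∫₀ᵗ W(max 0 (min s 1))^{1/p'} ds`. -/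
noncomputable def profile (p : ℝ) (W : ℝ → ℝ) (t : ℝ) : ℝ :=
  wellConst p W * ∫ s in (0 : ℝ)..t, truncatedDensity p W s

theorem conjExponent_pos {p : ℝ} (hp : 1 < p) : 0 < Real.conjExponent p := by
  have : 0 < p - 1 := by linarith
  rw [Real.conjExponent]
  positivity

theorem continuous_truncatedDensity {p : ℝ} (hp : 1 < p) {W : ℝ → ℝ} (hW : Continuous W) :
    Continuous (truncatedDensity p W) := by
  have := conjExponent_pos hp
  exact (hW.comp (by fun_prop)).rpow_const fun _ => Or.inr (by positivity)

theorem exists_bound_truncated {V : ℝ → ℝ} (hV : Continuous V) :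
    ∃ B : ℝ, 0 ≤ B ∧ ∀ s, |V (max 0 (min s 1))| ≤ B := by
  obtain ⟨B, hB⟩ := (isCompact_Icc (a := (0 : ℝ)) (b := 1)).exists_bound_of_continuousOn
    hV.continuousOn
  have h : ∀ s, |V (max 0 (min s 1))| ≤ B := fun s =>
    hB _ ⟨le_max_left _ _, max_le zero_le_one (min_le_right _ _)⟩
  exact ⟨B, (abs_nonneg _).trans (h 0), h⟩

theorem truncate_eq_self {s : ℝ} (h0 : 0 ≤ s) (h1 : s ≤ 1) : max 0 (min s 1) = s := by
  rw [min_eq_left h1, max_eq_right h0]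

theorem wellConst_pos {p : ℝ} (hp : 1 < p) {W : ℝ → ℝ} (hW : Continuous W)
    (hW0 : ∀ t, 0 ≤ W t) (hWz : ∀ t, W t = 0 ↔ t = 0 ∨ t = 1) : 0 < wellConst p W := by
  have hp' := conjExponent_pos hp
  have hc : Continuous fun s => W s ^ (1 / Real.conjExponent p) :=
    hW.rpow_const fun _ => Or.inr (by positivity)
  refine inv_pos.2 (intervalIntegral.intervalIntegral_pos_of_pos_on (hc.intervalIntegrable 0 1)
    (fun s hs => Real.rpow_pos_of_pos (lt_of_le_of_ne (hW0 s) fun h => ?_) _) zero_lt_one)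
  rcases (hWz s).1 h.symm with h | h
  · exact hs.1.ne' h
  · exact hs.2.ne h

theorem hasDerivAt_profile {p : ℝ} (hp : 1 < p) {W : ℝ → ℝ} (hW : Continuous W) (t : ℝ) :
    HasDerivAt (profile p W) (wellConst p W * truncatedDensity p W t) t :=
  ((continuous_truncatedDensity hp hW).integral_hasStrictDerivAt 0 t).hasDerivAt.const_mul _

theorem profile_zero (p : ℝ) (W : ℝ → ℝ) : profile p W 0 = 0 := by simp [profile]

/-- Truncating the argument of `W` bounds the density although `W` may be unbounded. The
approximating test functions need not take values in `[0, 1]`, whereas on phase fields the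
truncation is invisible. -/
theorem exists_lipschitzWith_profile {p : ℝ} (hp : 1 < p) {W : ℝ → ℝ} (hW : Continuous W) :
    ∃ L : ℝ≥0, LipschitzWith L (profile p W) := by
  have hp' := conjExponent_pos hp
  obtain ⟨B, hB0, hB⟩ := exists_bound_truncated (V := fun s => W s ^ (1 / Real.conjExponent p))
    (hW.rpow_const fun _ => Or.inr (by positivity))
  refine ⟨(|wellConst p W| * B).toNNReal, lipschitzWith_of_nnnorm_deriv_le
    (fun t => (hasDerivAt_profile hp hW t).differentiableAt) fun t => ?_⟩
  rw [(hasDerivAt_profile hp hW t).deriv, ← NNReal.coe_le_coe, coe_nnnorm, norm_mul,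
    Real.coe_toNNReal _ (by positivity)]
  exact mul_le_mul_of_nonneg_left (hB t) (abs_nonneg _)

theorem strictMonoOn_profile {p : ℝ} (hp : 1 < p) {W : ℝ → ℝ} (hW : Continuous W)
    (hW0 : ∀ t, 0 ≤ W t) (hWz : ∀ t, W t = 0 ↔ t = 0 ∨ t = 1) :
    StrictMonoOn (profile p W) (Icc 0 1) := by
  refine strictMonoOn_of_deriv_pos (convex_Icc 0 1)
    (fun t _ => (hasDerivAt_profile hp hW t).continuousAt.continuousWithinAt) fun t ht => ?_
  rw [interior_Icc] at ht
  rw [(hasDerivAt_profile hp hW t).deriv]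
  refine mul_pos (wellConst_pos hp hW hW0 hWz) (Real.rpow_pos_of_pos ?_ _)
  rw [truncate_eq_self ht.1.le ht.2.le]
  refine lt_of_le_of_ne (hW0 t) fun h => ?_
  rcases (hWz t).1 h.symm with h | h
  · exact ht.1.ne' h
  · exact ht.2.ne h

theorem contDiff_profile {p : ℝ} (hp : 1 < p) {W : ℝ → ℝ} (hW : Continuous W) :
    ContDiff ℝ 1 (profile p W) := by
  rw [contDiff_one_iff_deriv]
  refine ⟨fun t => (hasDerivAt_profile hp hW t).differentiableAt, ?_⟩
  have : deriv (profile p W) = fun t => wellConst p W * truncatedDensity p W t :=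
    funext fun t => (hasDerivAt_profile hp hW t).deriv
  rw [this]
  exact continuous_const.mul (continuous_truncatedDensity hp hW)

/-- The pointwise form of the Modica–Mortola inequality. -/
theorem rpow_mul_le_modicaMortola {p : ℝ} (hp : 1 < p) {ε : ℝ} (hε : 0 < ε) {A B : ℝ}
    (hA : 0 ≤ A) (hB : 0 ≤ B) :
    A ^ (1 / Real.conjExponent p) * B
      ≤ A / (Real.conjExponent p * ε) + ε ^ (p - 1) / p * B ^ p := by
  have hp0 : 0 < p := by linarith
  have hp1 : 0 < p - 1 := by linarith
  have hq := conjExponent_pos hp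
  have hpq : (Real.conjExponent p).HolderConjugate p := (Real.HolderConjugate.conjExponent hp).symm
  -- The factor `ε ^ (1 / p')` is moved between the two terms so that Young produces both weights of
  -- the functional; its `p`-th power is `ε ^ (p - 1)` because `p / p' = p - 1`.
  have hY := Real.young_inequality_of_nonneg
    (a := (A / ε) ^ (1 / Real.conjExponent p)) (b := ε ^ (1 / Real.conjExponent p) * B)
    (by positivity) (by positivity) hpq
  have e1 : (A / ε) ^ (1 / Real.conjExponent p) * (ε ^ (1 / Real.conjExponent p) * B)
      = A ^ (1 / Real.conjExponent p) * B := by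
    rw [← mul_assoc, ← Real.mul_rpow (by positivity) hε.le, div_mul_cancel₀ _ hε.ne']
  have e2 : ((A / ε) ^ (1 / Real.conjExponent p)) ^ Real.conjExponent p = A / ε := by
    rw [← Real.rpow_mul (by positivity), one_div_mul_cancel hq.ne', Real.rpow_one]
  have e3 : (ε ^ (1 / Real.conjExponent p) * B) ^ p = ε ^ (p - 1) * B ^ p := by
    rw [Real.mul_rpow (by positivity) hB, ← Real.rpow_mul hε.le]
    congr 2
    rw [Real.conjExponent]
    field_simp
  rw [e1, e2, e3] at hY
  refine hY.trans_eq ?_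
  field_simp

theorem norm_fderiv_profile_comp_le {p : ℝ} (hp : 1 < p) {W : ℝ → ℝ} (hW : Continuous W)
    (hW0 : ∀ t, 0 ≤ W t) (hc : 0 ≤ wellConst p W) {ε : ℝ} (hε : 0 < ε) {ψ : Plane → ℝ}
    (hψ : Differentiable ℝ ψ) (x : Plane) :
    ‖fderiv ℝ (fun y => profile p W (ψ y)) x‖ ≤
      wellConst p W / (Real.conjExponent p * ε) * W (max 0 (min (ψ x) 1)) +
        wellConst p W * ε ^ (p - 1) / p * ‖gradient ψ x‖ ^ p := by
  have h1 := (hasDerivAt_profile hp hW (ψ x)).comp_hasFDerivAt x (hψ x).hasFDerivAt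
  have h2 : fderiv ℝ (fun y => profile p W (ψ y)) x
      = (wellConst p W * truncatedDensity p W (ψ x)) • fderiv ℝ ψ x := h1.fderiv
  have ht : 0 ≤ truncatedDensity p W (ψ x) := Real.rpow_nonneg (hW0 _) _
  rw [h2, norm_smul, Real.norm_of_nonneg (mul_nonneg hc ht), ← norm_gradient, mul_assoc]
  refine (mul_le_mul_of_nonneg_left (rpow_mul_le_modicaMortola hp hε (hW0 _) (norm_nonneg _))
    hc).trans_eq ?_
  have := conjExponent_pos hp
  field_simp

theorem lintegral_profile_translation_le_of_testFunction {p : ℝ} (hp : 1 < p) {W : ℝ → ℝ}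
    (hW : Continuous W) (hW0 : ∀ t, 0 ≤ W t) (hc : 0 ≤ wellConst p W) {ε : ℝ} (hε : 0 < ε)
    {D : Set Plane} (hD : MeasurableSet D) {ψ : Plane → ℝ} (hψ : ψ ∈ testFunctions D)
    (τ : Plane) :
    ∫⁻ x, ‖profile p W (ψ (x + τ)) - profile p W (ψ x)‖ₑ ≤
      (ENNReal.ofReal (wellConst p W / (Real.conjExponent p * ε)) *
        (∫⁻ x in D, ENNReal.ofReal (W (max 0 (min (ψ x) 1)))) +
      ENNReal.ofReal (wellConst p W * ε ^ (p - 1) / p) *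
        (∫⁻ x in D, ENNReal.ofReal (‖gradient ψ x‖ ^ p))) * ‖τ‖ₑ := by
  have hp0 : 0 < p := by linarith
  have hq := conjExponent_pos hp
  have hψ1 := testFunctions.contDiff_one hψ
  have hcd : ContDiff ℝ 1 fun y => profile p W (ψ y) := (contDiff_profile hp hW).comp hψ1
  refine (lintegral_translation_le hcd τ).trans ?_
  gcongr
  have hzero : ∀ x, x ∉ D → fderiv ℝ (fun y => profile p W (ψ y)) x = 0 := by
    intro x hx
    have h1 := (hasDerivAt_profile hp hW (ψ x)).comp_hasFDerivAt x
      (hψ1.differentiable one_ne_zero x).hasFDerivAt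
    have h2 : fderiv ℝ (fun y => profile p W (ψ y)) x
        = (wellConst p W * truncatedDensity p W (ψ x)) • fderiv ℝ ψ x := h1.fderiv
    have h3 : fderiv ℝ ψ x = 0 := by
      by_contra h
      exact hx (hψ.2.2 (tsupport_fderiv_subset ℝ (subset_tsupport _ h)))
    rw [h2, h3, smul_zero]
  calc ∫⁻ x, ‖fderiv ℝ (fun y => profile p W (ψ y)) x‖ₑ
      = ∫⁻ x in D, ‖fderiv ℝ (fun y => profile p W (ψ y)) x‖ₑ := by
        rw [← lintegral_indicator hD]
        refine lintegral_congr fun x => ?_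
        by_cases hx : x ∈ D
        · rw [indicator_of_mem hx]
        · rw [indicator_of_notMem hx, hzero x hx, ← ofReal_norm, norm_zero, ENNReal.ofReal_zero]
    _ ≤ ∫⁻ x in D, (ENNReal.ofReal (wellConst p W / (Real.conjExponent p * ε)) *
          ENNReal.ofReal (W (max 0 (min (ψ x) 1))) +
        ENNReal.ofReal (wellConst p W * ε ^ (p - 1) / p) *
          ENNReal.ofReal (‖gradient ψ x‖ ^ p)) := by
        refine lintegral_mono fun x => ?_
        have := hW0 (max 0 (min (ψ x) 1))
        rw [← ofReal_norm, ← ENNReal.ofReal_mul (by positivity),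
          ← ENNReal.ofReal_mul (by positivity), ← ENNReal.ofReal_add (by positivity)
            (by positivity)]
        exact ENNReal.ofReal_le_ofReal
          (norm_fderiv_profile_comp_le hp hW hW0 hc hε (hψ1.differentiable one_ne_zero) x)
    _ = _ := by
        rw [lintegral_add_left (Continuous.measurable (by
          have := hψ1.continuous
          exact (ENNReal.continuous_const_mul ENNReal.ofReal_ne_top).comp
            (ENNReal.continuous_ofReal.comp (hW.comp (by fun_prop))))),
          lintegral_const_mul' _ _ ENNReal.ofReal_ne_top,
          lintegral_const_mul' _ _ ENNReal.ofReal_ne_top]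

theorem lintegral_ofReal_norm_rpow {α E : Type*} [MeasurableSpace α] [NormedAddCommGroup E]
    {μ : Measure α} {p : ℝ} (hp : 0 < p) (g : α → E) :
    ∫⁻ x, ENNReal.ofReal (‖g x‖ ^ p) ∂μ = eLpNorm g (ENNReal.ofReal p) μ ^ p := by
  rw [eLpNorm_eq_lintegral_rpow_enorm_toReal (by simpa using hp) ENNReal.ofReal_ne_top,
    ENNReal.toReal_ofReal hp.le, ← ENNReal.rpow_mul, one_div_mul_cancel hp.ne', ENNReal.rpow_one]
  refine lintegral_congr fun x => ?_
  rw [← ENNReal.ofReal_rpow_of_nonneg (norm_nonneg _) hp.le, ofReal_norm]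

/-- The bound for test functions passes to the limit: Fatou on the left, dominated convergence for
the truncated potential, and norm convergence for the gradients. The truncation disappears since `0
≤ u ≤ 1`. -/
theorem lintegral_profile_translation_le {p : ℝ} (hp : 1 < p) {W : ℝ → ℝ} (hW : Continuous W)
    (hW0 : ∀ t, 0 ≤ W t) (hc : 0 < wellConst p W) {R ε : ℝ} (hε : 0 < ε) (u : phaseFields R)
    (τ : Plane) :
    ∫⁻ x, ‖profile p W (u.1 (x + τ)) - profile p W (u.1 x)‖ₑ
      ≤ modicaMortola p W R ε u.1 * ‖τ‖ₑ := by
  have hp0 : 0 < p := by linarith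
  have hp1 : 1 ≤ ENNReal.ofReal p := by
    rw [← ENNReal.ofReal_one]
    exact ENNReal.ofReal_le_ofReal hp.le
  rcases eq_or_ne τ 0 with rfl | hτ
  · simp
  have hτ0 : ‖τ‖ₑ ≠ 0 := by simpa using hτ
  -- Dividing by `‖τ‖` turns the claim into a lower bound for the infimum, which can be checked for
  -- each admissible gradient.
  rw [← ENNReal.div_le_iff hτ0 enorm_ne_top]
  refine le_iInf₂ fun G hG => ?_
  rw [ENNReal.div_le_iff hτ0 enorm_ne_top]
  obtain ⟨⟨hu, hGm, -, ψ, hψ, h1, h2⟩, hu0⟩ := hG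
  set D := Metric.ball (0 : Plane) R with hD
  have hfin : IsFiniteMeasure (volume.restrict D) :=
    ⟨by rw [Measure.restrict_apply_univ]; exact measure_ball_lt_top⟩
  obtain ⟨ns, hns, hae⟩ := (tendstoInMeasure_of_tendsto_eLpNorm
    (by simpa using hp0 : ENNReal.ofReal p ≠ 0)
    (fun n => (memLp_testFunction (hψ n) (ENNReal.ofReal p)).aestronglyMeasurable)
    hu.aestronglyMeasurable h1).exists_seq_tendsto_ae
  have hae' : ∀ᵐ x ∂(volume : Measure Plane),
      Tendsto (fun k => ψ (ns k) x) atTop (𝓝 (u.1 x)) := by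
    rw [ae_restrict_iff' measurableSet_ball] at hae
    filter_upwards [hae, hu0] with x h3 h4
    by_cases hx : x ∈ D
    · exact h3 hx
    · have : ∀ k, ψ (ns k) x = 0 := fun k =>
        image_eq_zero_of_notMem_tsupport fun h => hx ((hψ _).2.2 h)
      simp_rw [this, h4 hx]
      exact tendsto_const_nhds
  have hΨ : Continuous (profile p W) := (contDiff_profile hp hW).continuous
  have hlimW : Tendsto (fun k => ∫⁻ x in D, ENNReal.ofReal (W (max 0 (min (ψ (ns k) x) 1)))) atTop
      (𝓝 (∫⁻ x in D, ENNReal.ofReal (W (u.1 x)))) := by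
    obtain ⟨B, -, hB⟩ := exists_bound_truncated hW
    refine tendsto_lintegral_of_dominated_convergence (fun _ => ENNReal.ofReal B)
      (fun k => ?_) (fun k => Eventually.of_forall fun x => ?_) ?_ ?_
    · have := (hψ (ns k)).1.continuous
      exact Continuous.measurable (ENNReal.continuous_ofReal.comp (hW.comp (by fun_prop)))
    · exact ENNReal.ofReal_le_ofReal ((le_abs_self _).trans (hB _))
    · rw [setLIntegral_const]
      exact ENNReal.mul_ne_top ENNReal.ofReal_ne_top measure_ball_lt_top.ne
    · refine ae_restrict_of_ae ?_
      filter_upwards [hae', u.2.1] with x h3 h4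
      have hcont : Continuous fun s : ℝ => ENNReal.ofReal (W (max 0 (min s 1))) :=
        ENNReal.continuous_ofReal.comp (hW.comp (by fun_prop))
      have := (hcont.tendsto _).comp h3
      rwa [truncate_eq_self h4.1 h4.2] at this
  -- Minkowski bounds the norm of the test gradient by this sum, and only its limit is needed.
  have hlimG : Tendsto (fun k => (eLpNorm (fun x => gradient (ψ (ns k)) x - G x)
      (ENNReal.ofReal p) (volume.restrict D) + eLpNorm G (ENNReal.ofReal p)
      (volume.restrict D)) ^ p) atTop (𝓝 (∫⁻ x in D, ENNReal.ofReal (‖G x‖ ^ p))) := by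
    rw [lintegral_ofReal_norm_rpow hp0]
    have := ((h2.comp hns.tendsto_atTop).add_const
      (eLpNorm G (ENNReal.ofReal p) (volume.restrict D))).ennrpow_const p
    rwa [zero_add] at this
  have hlim := (ENNReal.Tendsto.mul_const (b := ‖τ‖ₑ) ((ENNReal.Tendsto.const_mul
    (a := ENNReal.ofReal (wellConst p W / (Real.conjExponent p * ε))) hlimW
      (Or.inr ENNReal.ofReal_ne_top)).add (ENNReal.Tendsto.const_mul
    (a := ENNReal.ofReal (wellConst p W * ε ^ (p - 1) / p)) hlimG
      (Or.inr ENNReal.ofReal_ne_top))) (Or.inr enorm_ne_top))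
  calc ∫⁻ x, ‖profile p W (u.1 (x + τ)) - profile p W (u.1 x)‖ₑ
      = ∫⁻ x, liminf (fun k =>
          ‖profile p W (ψ (ns k) (x + τ)) - profile p W (ψ (ns k) x)‖ₑ) atTop := by
        refine lintegral_congr_ae ?_
        filter_upwards [hae', ae_comp_add_right hae' τ] with x h1 h2
        exact (((hΨ.tendsto _).comp h2).sub ((hΨ.tendsto _).comp h1)).enorm.liminf_eq.symm
    _ ≤ liminf (fun k => ∫⁻ x,
          ‖profile p W (ψ (ns k) (x + τ)) - profile p W (ψ (ns k) x)‖ₑ) atTop := by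
        refine lintegral_liminf_le' fun k => ?_
        have := (hψ (ns k)).1.continuous
        exact (Continuous.measurable (Continuous.enorm (by fun_prop))).aemeasurable
    _ ≤ _ := by
        rw [← hlim.liminf_eq]
        refine liminf_le_liminf (Eventually.of_forall fun k => ?_)
        refine (lintegral_profile_translation_le_of_testFunction hp hW hW0 hc.le hε
          measurableSet_ball (hψ (ns k)) τ).trans ?_
        rw [lintegral_ofReal_norm_rpow hp0]
        gcongr
        have hsum : gradient (ψ (ns k)) = (fun x => gradient (ψ (ns k)) x - G x) + G := by
          ext x : 1; simp
        nth_rewrite 1 [hsum]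
        exact eLpNorm_add_le ((memLp_gradient_testFunction (hψ (ns k))
          (ENNReal.ofReal p)).sub hGm).aestronglyMeasurable hGm.aestronglyMeasurable hp1

/-! ### Parametric integrals -/

section Parametric

set_option linter.unusedSectionVars false

variable {Z : Type*} [NormedAddCommGroup Z] [NormedSpace ℝ Z] [FiniteDimensional ℝ Z]
  [MeasurableSpace Z] [BorelSpace Z] {ν : Measure Z} {k : Plane × Z → ℂ} {S : Set Z}

theorem exists_bound_kernel (hk : ContDiff ℝ 1 k) (hS : IsCompact S) (r : ℝ) :
    ∃ C, 0 ≤ C ∧ ∀ x ∈ Metric.ball (0 : Plane) r, ∀ z ∈ S, ‖k (x, z)‖ ≤ C ∧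
      ‖(fderiv ℝ k (x, z)).comp (ContinuousLinearMap.inl ℝ Plane Z)‖ ≤ C := by
  have hc : IsCompact (Metric.closedBall (0 : Plane) r ×ˢ S) :=
    (isCompact_closedBall _ _).prod hS
  obtain ⟨C₁, h1⟩ := hc.exists_bound_of_continuousOn hk.continuous.continuousOn
  obtain ⟨C₂, h2⟩ := hc.exists_bound_of_continuousOn
    (f := fun y => (fderiv ℝ k y).comp (ContinuousLinearMap.inl ℝ Plane Z))
    ((hk.continuous_fderiv one_ne_zero).clm_comp continuous_const).continuousOn
  refine ⟨max 0 (max C₁ C₂), le_max_left _ _, fun x hx z hz => ?_⟩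
  have hm : (x, z) ∈ Metric.closedBall (0 : Plane) r ×ˢ S :=
    ⟨Metric.ball_subset_closedBall hx, hz⟩
  exact ⟨(h1 _ hm).trans ((le_max_left _ _).trans (le_max_right _ _)),
    (h2 _ hm).trans ((le_max_right _ _).trans (le_max_right _ _))⟩

theorem integrable_mul_kernel (hk : ContDiff ℝ 1 k) (hS : IsCompact S) {w : Z → ℂ}
    (hw : Integrable w ν) (hwS : ∀ᵐ z ∂ν, z ∉ S → w z = 0) (x : Plane) :
    Integrable (fun z => w z * k (x, z)) ν := by
  obtain ⟨C, -, hC⟩ := exists_bound_kernel hk hS (‖x‖ + 1)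
  have hkx : Continuous fun z => k (x, z) := hk.continuous.comp (by fun_prop)
  refine (hw.norm.const_mul C).mono' (hw.aestronglyMeasurable.mul
    hkx.aestronglyMeasurable) ?_
  filter_upwards [hwS] with z hz
  by_cases hzS : z ∈ S
  · rw [norm_mul, mul_comm]
    exact mul_le_mul_of_nonneg_right
      (hC x (mem_ball_zero_iff.2 (lt_add_one _)) z hzS).1 (norm_nonneg _)
  · rw [hz hzS]; simp

theorem hasFDerivAt_integral_kernel (hk : ContDiff ℝ 1 k) (hS : IsCompact S) {w : Z → ℂ}
    (hw : Integrable w ν) (hwS : ∀ᵐ z ∂ν, z ∉ S → w z = 0) (x : Plane) :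
    HasFDerivAt (fun x => ∫ z, w z * k (x, z) ∂ν)
      (∫ z, w z • (fderiv ℝ k (x, z)).comp (ContinuousLinearMap.inl ℝ Plane Z) ∂ν) x := by
  obtain ⟨C, -, hC⟩ := exists_bound_kernel hk hS (‖x‖ + 1)
  have hkc : ∀ x, Continuous fun z => k (x, z) := fun x => hk.continuous.comp (by fun_prop)
  have hkd : Continuous fun z => (fderiv ℝ k (x, z)).comp (ContinuousLinearMap.inl ℝ Plane Z) :=
    ((hk.continuous_fderiv one_ne_zero).comp (by fun_prop)).clm_comp continuous_const
  refine hasFDerivAt_integral_of_dominated_of_fderiv_le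
    (F := fun x z => w z * k (x, z))
    (F' := fun x z => w z • (fderiv ℝ k (x, z)).comp (ContinuousLinearMap.inl ℝ Plane Z))
    (bound := fun z => C * ‖w z‖)
    (Metric.isOpen_ball.mem_nhds (mem_ball_zero_iff.2 (lt_add_one ‖x‖)))
    (Eventually.of_forall fun y => hw.aestronglyMeasurable.mul (hkc y).aestronglyMeasurable)
    (integrable_mul_kernel hk hS hw hwS x)
    (hw.aestronglyMeasurable.smul hkd.aestronglyMeasurable) ?_ (hw.norm.const_mul C) ?_
  · filter_upwards [hwS] with z hz y hy
    by_cases hzS : z ∈ S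
    · rw [norm_smul, mul_comm]
      exact mul_le_mul_of_nonneg_right (hC y hy z hzS).2 (norm_nonneg _)
    · rw [hz hzS]; simp
  · refine Eventually.of_forall fun z y _ => HasFDerivAt.const_mul ?_ (w z)
    exact (hk.differentiable one_ne_zero (y, z)).hasFDerivAt.comp y (hasFDerivAt_prodMk_left y z)

/-- The constant is independent of the density `w`; applied to differences of densities, this gives
Lipschitz dependence on the density in `L¹`. -/
theorem exists_bound_integral_kernel (hk : ContDiff ℝ 1 k) (hS : IsCompact S) (r : ℝ) :
    ∃ C, 0 ≤ C ∧ ∀ w : Z → ℂ, Integrable w ν → (∀ᵐ z ∂ν, z ∉ S → w z = 0) →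
      ∀ x ∈ Metric.ball (0 : Plane) r, ‖∫ z, w z * k (x, z) ∂ν‖ ≤ C * ∫ z, ‖w z‖ ∂ν ∧
        ‖fderiv ℝ (fun x => ∫ z, w z * k (x, z) ∂ν) x‖ ≤ C * ∫ z, ‖w z‖ ∂ν := by
  obtain ⟨C, hC0, hC⟩ := exists_bound_kernel hk hS r
  refine ⟨C, hC0, fun w hw hwS x hx => ⟨?_, ?_⟩⟩
  · rw [← integral_const_mul]
    refine norm_integral_le_of_norm_le (hw.norm.const_mul C) ?_
    filter_upwards [hwS] with z hz
    by_cases hzS : z ∈ S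
    · rw [norm_mul, mul_comm]
      exact mul_le_mul_of_nonneg_right (hC x hx z hzS).1 (norm_nonneg _)
    · rw [hz hzS]; simp
  · rw [(hasFDerivAt_integral_kernel hk hS hw hwS x).fderiv, ← integral_const_mul]
    refine norm_integral_le_of_norm_le (hw.norm.const_mul C) ?_
    filter_upwards [hwS] with z hz
    by_cases hzS : z ∈ S
    · rw [norm_smul, mul_comm]
      exact mul_le_mul_of_nonneg_right (hC x hx z hzS).2 (norm_nonneg _)
    · rw [norm_smul, hz hzS, norm_zero, zero_mul, mul_zero]

end Parametric

/-! ### The aerial intensity -/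

theorem IsFourierOfNonneg.continuous {J : Plane → ℂ} (hJ : IsFourierOfNonneg J) :
    Continuous J := by
  obtain ⟨Jh, hJi, -, hJe⟩ := hJ
  have : J = fun x => ∫ ξ, (Jh ξ : ℂ) * Complex.exp (-(Complex.I * (inner ℝ ξ x : ℝ))) :=
    funext hJe
  rw [this]
  have hexp : Continuous fun y : Plane × Plane =>
      Complex.exp (-(Complex.I * (inner ℝ y.2 y.1 : ℝ))) := by fun_prop
  refine continuous_of_dominated (bound := fun ξ => ‖Jh ξ‖) (fun x => ?_)
    (fun x => Eventually.of_forall fun ξ => ?_) hJi.norm (Eventually.of_forall fun ξ => ?_)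
  · exact hJi.ofReal.aestronglyMeasurable.mul
      (hexp.comp (Continuous.prodMk_right x)).aestronglyMeasurable
  · rw [norm_mul, Complex.norm_exp]
    simp
  · exact continuous_const.mul (hexp.comp (Continuous.prodMk_left ξ))

theorem IsFourierOfNonneg.exists_bound {J : Plane → ℂ} (hJ : IsFourierOfNonneg J) :
    ∃ M, 0 ≤ M ∧ ∀ x, ‖J x‖ ≤ M := by
  obtain ⟨Jh, hJi, -, hJe⟩ := hJ
  refine ⟨∫ ξ, ‖Jh ξ‖, integral_nonneg fun _ => norm_nonneg _, fun x => ?_⟩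
  rw [hJe]
  refine norm_integral_le_of_norm_le hJi.norm (Eventually.of_forall fun ξ => ?_)
  rw [norm_mul, Complex.norm_exp]
  simp

/-- The mutual intensity `u(ξ) J(ξ - ζ) u(ζ)` at the point `(ζ, ξ)`. -/
noncomputable def mutualIntensity (J : Plane → ℂ) (u : Plane → ℝ) (z : Plane × Plane) : ℂ :=
  u z.2 * J (z.2 - z.1) * u z.1

/-- The kernel `K(x - ξ) conj(K(x - ζ))` at `(x, (ζ, ξ))`. -/
noncomputable def transferKernel (K : Plane → ℂ) (y : Plane × Plane × Plane) : ℂ :=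
  K (y.1 - y.2.2) * conj (K (y.1 - y.2.1))

theorem contDiff_transferKernel {K : Plane → ℂ} (hK : ContDiff ℝ 1 K) :
    ContDiff ℝ 1 (transferKernel K) := by
  have h1 : ContDiff ℝ 1 fun y : Plane × Plane × Plane => K (y.1 - y.2.2) :=
    hK.comp (contDiff_fst.sub (contDiff_snd.comp contDiff_snd))
  have h2 : ContDiff ℝ 1 fun y : Plane × Plane × Plane => K (y.1 - y.2.1) :=
    hK.comp (contDiff_fst.sub (contDiff_fst.comp contDiff_snd))
  exact h1.mul (Complex.conjCLE.contDiff.comp h2)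

theorem integrable_mutualIntensity {J : Plane → ℂ} (hJ : IsFourierOfNonneg J) {R : ℝ}
    (u : phaseFields R) : Integrable (mutualIntensity J u.1) := by
  obtain ⟨M, -, hM⟩ := hJ.exists_bound
  have hu := L1.integrable_coeFn u.1
  have h1 : Integrable fun z : Plane × Plane => (u.1 z.1 : ℂ) * (u.1 z.2 : ℂ) :=
    hu.ofReal.mul_prod hu.ofReal
  have h2 := h1.bdd_mul (f := fun z : Plane × Plane => J (z.2 - z.1)) (c := M)
    (hJ.continuous.comp (continuous_snd.sub continuous_fst)).aestronglyMeasurable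
    (Eventually.of_forall fun z => hM _)
  refine h2.congr (Eventually.of_forall fun z => ?_)
  simp only [mutualIntensity]
  ring

theorem mutualIntensity_eq_zero {J : Plane → ℂ} {R : ℝ} (u : phaseFields R) :
    ∀ᵐ z ∂(volume : Measure (Plane × Plane)),
      z ∉ Metric.closedBall (0 : Plane) R ×ˢ Metric.closedBall (0 : Plane) R →
        mutualIntensity J u.1 z = 0 := by
  have h1 : ∀ᵐ z ∂(volume : Measure (Plane × Plane)),
      z.1 ∉ Metric.ball (0 : Plane) R → u.1 z.1 = 0 :=
    Measure.quasiMeasurePreserving_fst.ae u.2.2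
  have h2 : ∀ᵐ z ∂(volume : Measure (Plane × Plane)),
      z.2 ∉ Metric.ball (0 : Plane) R → u.1 z.2 = 0 :=
    Measure.quasiMeasurePreserving_snd.ae u.2.2
  filter_upwards [h1, h2] with z h1 h2 hz
  rw [mem_prod, not_and_or] at hz
  rcases hz with hz | hz
  · rw [mutualIntensity, h1 fun h => hz (Metric.ball_subset_closedBall h)]; simp
  · rw [mutualIntensity, h2 fun h => hz (Metric.ball_subset_closedBall h)]; simp

/-- The mutual intensity is quadratic in `u`. The difference is telescoped one factor at a time,
with `J` bounded and the `L¹` norms of the fields bounded by the area of the ball. -/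
theorem integral_norm_mutualIntensity_sub_le {J : Plane → ℂ} (hJ : IsFourierOfNonneg J) (R : ℝ) :
    ∃ C, 0 ≤ C ∧ ∀ u v : phaseFields R,
      ∫ z, ‖mutualIntensity J u.1 z - mutualIntensity J v.1 z‖ ≤ C * ‖u.1 - v.1‖ := by
  obtain ⟨M, hM0, hM⟩ := hJ.exists_bound
  refine ⟨M * (2 * volume.real (Metric.ball (0 : Plane) R)), by positivity, fun u v => ?_⟩
  have hu := L1.integrable_coeFn u.1
  have hv := L1.integrable_coeFn v.1
  have hd := L1.integrable_coeFn (u.1 - v.1)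
  have hI1 : Integrable fun z : Plane × Plane => ‖u.1 z.1‖ * ‖(u.1 - v.1) z.2‖ :=
    hu.norm.mul_prod hd.norm
  have hI2 : Integrable fun z : Plane × Plane => ‖(u.1 - v.1) z.1‖ * ‖v.1 z.2‖ :=
    hd.norm.mul_prod hv.norm
  have hs1 : ∀ᵐ z ∂(volume : Measure (Plane × Plane)),
      (u.1 - v.1) z.1 = u.1 z.1 - v.1 z.1 :=
    Measure.quasiMeasurePreserving_fst.ae (Lp.coeFn_sub u.1 v.1)
  have hs2 : ∀ᵐ z ∂(volume : Measure (Plane × Plane)),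
      (u.1 - v.1) z.2 = u.1 z.2 - v.1 z.2 :=
    Measure.quasiMeasurePreserving_snd.ae (Lp.coeFn_sub u.1 v.1)
  calc ∫ z, ‖mutualIntensity J u.1 z - mutualIntensity J v.1 z‖
      ≤ ∫ z : Plane × Plane,
          M * (‖u.1 z.1‖ * ‖(u.1 - v.1) z.2‖ + ‖(u.1 - v.1) z.1‖ * ‖v.1 z.2‖) := by
        refine integral_mono_ae ((integrable_mutualIntensity hJ u).sub
          (integrable_mutualIntensity hJ v)).norm ((hI1.add hI2).const_mul M) ?_
        filter_upwards [hs1, hs2] with z h1 h2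
        have e : mutualIntensity J u.1 z - mutualIntensity J v.1 z
            = J (z.2 - z.1) * (u.1 z.1 * ((u.1 z.2 - v.1 z.2 : ℝ) : ℂ)
              + ((u.1 z.1 - v.1 z.1 : ℝ) : ℂ) * v.1 z.2) := by
          simp only [mutualIntensity]; push_cast; ring
        rw [e, norm_mul, h1, h2]
        refine mul_le_mul (hM _) ((norm_add_le _ _).trans_eq ?_) (norm_nonneg _) hM0
        rw [norm_mul, norm_mul]
        simp only [Complex.norm_real]
    _ = M * (‖u.1‖ * ‖u.1 - v.1‖ + ‖u.1 - v.1‖ * ‖v.1‖) := by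
        rw [integral_const_mul, integral_add hI1 hI2]
        rw [L1.norm_eq_integral_norm u.1, L1.norm_eq_integral_norm v.1,
          L1.norm_eq_integral_norm (u.1 - v.1)]
        have e1 := integral_prod_mul (μ := (volume : Measure Plane)) (ν := (volume : Measure Plane))
          (fun x => ‖u.1 x‖) (fun x => ‖(u.1 - v.1) x‖)
        have e2 := integral_prod_mul (μ := (volume : Measure Plane)) (ν := (volume : Measure Plane))
          (fun x => ‖(u.1 - v.1) x‖) (fun x => ‖v.1 x‖)
        rw [← e1, ← e2]; rfl
    _ ≤ M * (2 * volume.real (Metric.ball (0 : Plane) R)) * ‖u.1 - v.1‖ := by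
        rw [mul_assoc]
        refine mul_le_mul_of_nonneg_left ?_ hM0
        nlinarith [phaseFields_norm_le u, phaseFields_norm_le v, norm_nonneg (u.1 - v.1)]

/-- Fubini separates the `x`-dependence, carried by a fixed `C¹` kernel, from a compactly supported
density depending on `u`; the parametric integral estimates then apply. -/
theorem intensity_eq {K J : Plane → ℂ} (hK : ContDiff ℝ 1 K) (hJ : IsFourierOfNonneg J) {R : ℝ}
    (u : phaseFields R) (x : Plane) :
    intensity K J u.1 x = (∫ z, mutualIntensity J u.1 z * transferKernel K (x, z)).re := by
  have hI := integrable_mul_kernel (contDiff_transferKernel hK)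
    ((isCompact_closedBall (0 : Plane) R).prod (isCompact_closedBall (0 : Plane) R))
    (integrable_mutualIntensity hJ u) (mutualIntensity_eq_zero u) x
  have h := integral_prod (μ := (volume : Measure Plane)) (ν := (volume : Measure Plane)) _ hI
  rw [intensity, show (∫ z, mutualIntensity J u.1 z * transferKernel K (x, z)) = _ from h]
  congr 2
  ext ζ
  congr 1
  ext ξ
  simp only [mutualIntensity, transferKernel]
  ring

theorem differentiable_intensity {K J : Plane → ℂ} (hK : ContDiff ℝ 1 K)
    (hJ : IsFourierOfNonneg J) {R : ℝ} (u : phaseFields R) :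
    Differentiable ℝ (intensity K J u.1) := by
  have : intensity K J u.1 = fun x => Complex.reCLM
      (∫ z, mutualIntensity J u.1 z * transferKernel K (x, z)) :=
    funext fun x => intensity_eq hK hJ u x
  rw [this]
  intro x
  exact (Complex.reCLM.hasFDerivAt.comp x (hasFDerivAt_integral_kernel (contDiff_transferKernel hK)
    ((isCompact_closedBall (0 : Plane) R).prod (isCompact_closedBall (0 : Plane) R))
    (integrable_mutualIntensity hJ u) (mutualIntensity_eq_zero u) x)).differentiableAt

theorem intensity_sub_le {K J : Plane → ℂ} (hK : ContDiff ℝ 1 K) (hJ : IsFourierOfNonneg J)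
    (R r : ℝ) : ∃ C, 0 ≤ C ∧ ∀ u v : phaseFields R, ∀ x ∈ Metric.ball (0 : Plane) r,
      |intensity K J u.1 x - intensity K J v.1 x| ≤ C * ‖u.1 - v.1‖ ∧
      ‖fderiv ℝ (intensity K J u.1) x - fderiv ℝ (intensity K J v.1) x‖ ≤ C * ‖u.1 - v.1‖ := by
  have hk := contDiff_transferKernel hK
  have hS := (isCompact_closedBall (0 : Plane) R).prod (isCompact_closedBall (0 : Plane) R)
  obtain ⟨C₁, hC₁, h1⟩ := integral_norm_mutualIntensity_sub_le hJ R
  obtain ⟨C₂, hC₂, h2⟩ := exists_bound_integral_kernel (ν := volume) hk hS r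
  refine ⟨C₂ * C₁, by positivity, fun u v x hx => ?_⟩
  have hIu := integrable_mutualIntensity hJ u
  have hIv := integrable_mutualIntensity hJ v
  have hzero : ∀ᵐ z ∂(volume : Measure (Plane × Plane)),
      z ∉ Metric.closedBall (0 : Plane) R ×ˢ Metric.closedBall (0 : Plane) R →
        mutualIntensity J u.1 z - mutualIntensity J v.1 z = 0 := by
    filter_upwards [mutualIntensity_eq_zero (J := J) u, mutualIntensity_eq_zero (J := J) v]
      with z ha hb hz
    rw [ha hz, hb hz, sub_zero]
  have hb := h2 _ (hIu.sub hIv) hzero x hx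
  have heq : ∀ y, intensity K J u.1 y - intensity K J v.1 y = Complex.reCLM (∫ z,
      (mutualIntensity J u.1 z - mutualIntensity J v.1 z) * transferKernel K (y, z)) := by
    intro y
    rw [intensity_eq hK hJ, intensity_eq hK hJ, ← Complex.sub_re, ← integral_sub
      (integrable_mul_kernel hk hS hIu (mutualIntensity_eq_zero u) y)
      (integrable_mul_kernel hk hS hIv (mutualIntensity_eq_zero v) y)]
    simp_rw [sub_mul]
    rfl
  have hle : C₂ * ∫ z, ‖mutualIntensity J u.1 z - mutualIntensity J v.1 z‖
      ≤ C₂ * C₁ * ‖u.1 - v.1‖ := by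
    rw [mul_assoc]
    exact mul_le_mul_of_nonneg_left (h1 u v) hC₂
  constructor
  · rw [heq]
    exact ((Complex.abs_re_le_norm _).trans hb.1).trans hle
  · rw [← fderiv_fun_sub (differentiable_intensity hK hJ u x) (differentiable_intensity hK hJ v x),
      funext heq]
    have hd := hasFDerivAt_integral_kernel hk hS (hIu.sub hIv) hzero x
    have hd2 := (Complex.reCLM.hasFDerivAt.comp x hd).fderiv
    have hd3 := hd.fderiv
    refine le_trans ?_ (hb.2.trans hle)
    change ‖fderiv ℝ (Complex.reCLM ∘ fun x => ∫ z,
      (mutualIntensity J u.1 - mutualIntensity J v.1) z * transferKernel K (x, z)) x‖ ≤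
      ‖fderiv ℝ (fun x => ∫ z,
      (mutualIntensity J u.1 - mutualIntensity J v.1) z * transferKernel K (x, z)) x‖
    rw [hd2, hd3]
    refine (ContinuousLinearMap.opNorm_comp_le _ _).trans ?_
    rw [Complex.reCLM_norm, one_mul]

theorem tendsto_intensity {K J : Plane → ℂ} (hK : ContDiff ℝ 1 K) (hJ : IsFourierOfNonneg J)
    {R : ℝ} {u : ℕ → phaseFields R} {u₀ : phaseFields R} (h : Tendsto u atTop (𝓝 u₀)) (x : Plane) :
    Tendsto (fun n => intensity K J (u n).1 x) atTop (𝓝 (intensity K J u₀.1 x)) ∧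
    Tendsto (fun n => fderiv ℝ (intensity K J (u n).1) x) atTop
      (𝓝 (fderiv ℝ (intensity K J u₀.1) x)) := by
  obtain ⟨C, -, hC⟩ := intensity_sub_le hK hJ R (‖x‖ + 1)
  have h1 : Tendsto (fun n => (u n).1) atTop (𝓝 u₀.1) := (continuous_subtype_val.tendsto _).comp h
  have h2 : Tendsto (fun n => C * ‖(u n).1 - u₀.1‖) atTop (𝓝 0) := by
    simpa using (tendsto_iff_norm_sub_tendsto_zero.1 h1).const_mul C
  have hx : x ∈ Metric.ball (0 : Plane) (‖x‖ + 1) := mem_ball_zero_iff.2 (lt_add_one _)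
  exact ⟨tendsto_iff_norm_sub_tendsto_zero.2
      (squeeze_zero (fun _ => norm_nonneg _) (fun n => (hC (u n) u₀ x hx).1) h2),
    tendsto_iff_norm_sub_tendsto_zero.2
      (squeeze_zero (fun _ => norm_nonneg _) (fun n => (hC (u n) u₀ x hx).2) h2)⟩

/-- The zero phase field. -/
noncomputable def zeroField (R : ℝ) : phaseFields R :=
  ⟨0, by
    filter_upwards [Lp.coeFn_zero ℝ 1 (volume : Measure Plane)] with x hx
    rw [hx]; simp, by
    filter_upwards [Lp.coeFn_zero ℝ 1 (volume : Measure Plane)] with x hx _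
    rw [hx]; simp⟩

theorem zeroField_ae (R : ℝ) : ∀ᵐ x ∂(volume : Measure Plane), (zeroField R).1 x = 0 :=
  Lp.coeFn_zero ℝ 1 (volume : Measure Plane)

theorem intensity_zeroField {K J : Plane → ℂ} (hK : ContDiff ℝ 1 K) (hJ : IsFourierOfNonneg J)
    (R : ℝ) : intensity K J (zeroField R).1 = fun _ => 0 := by
  ext x
  rw [intensity_eq hK hJ]
  have : ∫ z, mutualIntensity J (zeroField R).1 z * transferKernel K (x, z) = 0 := by
    refine integral_eq_zero_of_ae ?_
    have h1 : ∀ᵐ z ∂(volume : Measure (Plane × Plane)), (zeroField R).1 z.1 = 0 :=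
      Measure.quasiMeasurePreserving_fst.ae (zeroField_ae R)
    filter_upwards [h1] with z hz
    simp [mutualIntensity, hz]
  rw [this, Complex.zero_re]

/-- The Lipschitz estimate against the zero field, whose intensity vanishes; all phase fields have
`L¹` norm at most the area of the ball. -/
theorem exists_bound_intensity {K J : Plane → ℂ} (hK : ContDiff ℝ 1 K) (hJ : IsFourierOfNonneg J)
    (R r : ℝ) : ∃ C, 0 ≤ C ∧ ∀ u : phaseFields R, ∀ x ∈ Metric.ball (0 : Plane) r,
      |intensity K J u.1 x| ≤ C ∧ ‖fderiv ℝ (intensity K J u.1) x‖ ≤ C := by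
  obtain ⟨C, hC0, hC⟩ := intensity_sub_le hK hJ R r
  refine ⟨C * volume.real (Metric.ball (0 : Plane) R), by positivity, fun u x hx => ?_⟩
  have h1 := hC u (zeroField R) x hx
  have h0 : u.1 - (zeroField R).1 = u.1 := sub_zero _
  rw [intensity_zeroField hK hJ, h0] at h1
  simp only [sub_zero, fderiv_fun_const, Pi.zero_apply] at h1
  have h2 := mul_le_mul_of_nonneg_left (phaseFields_norm_le u) hC0
  exact ⟨h1.1.trans h2, h1.2.trans h2⟩

/-! ### The smoothed pattern -/

section SmoothPattern

variable {K J : Plane → ℂ} {ϕ : ℝ → ℝ} {R : ℝ}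

theorem hasFDerivAt_smoothPattern (hK : ContDiff ℝ 1 K) (hJ : IsFourierOfNonneg J)
    (hϕ : ContDiff ℝ 1 ϕ) (h η : ℝ) (u : phaseFields R) (x : Plane) :
    HasFDerivAt (smoothPattern K J ϕ h η u.1)
      ((deriv ϕ ((intensity K J u.1 x - h) / η) / η) • fderiv ℝ (intensity K J u.1) x) x := by
  have h1 : HasDerivAt (fun t : ℝ => (t - h) / η) (1 / η) (intensity K J u.1 x) :=
    ((hasDerivAt_id _).sub_const h).div_const η
  have h2 := (hϕ.differentiable one_ne_zero ((intensity K J u.1 x - h) / η)).hasDerivAt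
  have h3 := (h2.comp (intensity K J u.1 x) h1).comp_hasFDerivAt x
    (differentiable_intensity hK hJ u x).hasFDerivAt
  rw [mul_one_div] at h3
  exact h3

theorem exists_bound_smoothPattern (hK : ContDiff ℝ 1 K) (hJ : IsFourierOfNonneg J)
    (hϕ : ContDiff ℝ 1 ϕ) (h η r : ℝ) :
    ∃ C, 0 ≤ C ∧ ∀ u : phaseFields R, ∀ x ∈ Metric.ball (0 : Plane) r,
      |smoothPattern K J ϕ h η u.1 x| ≤ C ∧
      ‖fderiv ℝ (smoothPattern K J ϕ h η u.1) x‖ ≤ C := by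
  obtain ⟨C, hC0, hC⟩ := exists_bound_intensity hK hJ R r
  have hc1 : Continuous fun t : ℝ => ϕ ((t - h) / η) := hϕ.continuous.comp (by fun_prop)
  have hc2 : Continuous fun t : ℝ => deriv ϕ ((t - h) / η) / η :=
    ((hϕ.continuous_deriv le_rfl).comp (by fun_prop)).div_const η
  obtain ⟨B₁, hB₁⟩ := (isCompact_Icc (a := -C) (b := C)).exists_bound_of_continuousOn
    hc1.continuousOn
  obtain ⟨B₂, hB₂⟩ := (isCompact_Icc (a := -C) (b := C)).exists_bound_of_continuousOn
    hc2.continuousOn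
  have hB₂0 : 0 ≤ B₂ := (norm_nonneg _).trans (hB₂ 0 ⟨by linarith, hC0⟩)
  refine ⟨max 0 (max B₁ (B₂ * C)), le_max_left _ _, fun u x hx => ?_⟩
  obtain ⟨h1, h2⟩ := hC u x hx
  have hm : intensity K J u.1 x ∈ Icc (-C) C := abs_le.1 h1
  refine ⟨(hB₁ _ hm).trans ((le_max_left _ _).trans (le_max_right _ _)), ?_⟩
  rw [(hasFDerivAt_smoothPattern hK hJ hϕ h η u x).fderiv, norm_smul]
  exact (mul_le_mul (hB₂ _ hm) h2 (norm_nonneg _) hB₂0).trans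
    ((le_max_right _ _).trans (le_max_right _ _))

theorem tendsto_smoothPattern (hK : ContDiff ℝ 1 K) (hJ : IsFourierOfNonneg J)
    (hϕ : ContDiff ℝ 1 ϕ) (h η : ℝ) {u : ℕ → phaseFields R} {u₀ : phaseFields R}
    (hu : Tendsto u atTop (𝓝 u₀)) (x : Plane) :
    Tendsto (fun n => smoothPattern K J ϕ h η (u n).1 x) atTop
      (𝓝 (smoothPattern K J ϕ h η u₀.1 x)) ∧
    Tendsto (fun n => fderiv ℝ (smoothPattern K J ϕ h η (u n).1) x) atTop
      (𝓝 (fderiv ℝ (smoothPattern K J ϕ h η u₀.1) x)) := by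
  obtain ⟨h1, h2⟩ := tendsto_intensity hK hJ hu x
  have hc1 : Continuous fun t : ℝ => ϕ ((t - h) / η) := hϕ.continuous.comp (by fun_prop)
  have hc2 : Continuous fun t : ℝ => deriv ϕ ((t - h) / η) / η :=
    ((hϕ.continuous_deriv le_rfl).comp (by fun_prop)).div_const η
  refine ⟨(hc1.tendsto _).comp h1, ?_⟩
  simp_rw [fun v : phaseFields R => (hasFDerivAt_smoothPattern hK hJ hϕ h η v x).fderiv]
  exact ((hc2.tendsto _).comp h1).smul h2

end SmoothPattern

/-! ### Total variation of differentiable functions -/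

theorem contDiff_component {D : Set Plane} {ψ : Plane → Plane} (hψ : ψ ∈ unitFields D)
    (i : Fin 2) : ContDiff ℝ 1 fun y => ψ y i :=
  (EuclideanSpace.proj (𝕜 := ℝ) i : Plane →L[ℝ] ℝ).contDiff.comp hψ.1

theorem hasCompactSupport_component {D : Set Plane} {ψ : Plane → Plane} (hψ : ψ ∈ unitFields D)
    (i : Fin 2) : HasCompactSupport fun y => ψ y i :=
  hψ.2.1.comp_left (g := fun v : Plane => v i) rfl

theorem continuous_divergence {D : Set Plane} {ψ : Plane → Plane} (hψ : ψ ∈ unitFields D) :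
    Continuous (divergence ψ) :=
  continuous_finsetSum _ fun i _ => continuous_partialDeriv (contDiff_component hψ i) i

theorem divergence_eq_zero_of_notMem {ψ : Plane → Plane} {x : Plane} (hx : x ∉ tsupport ψ) :
    divergence ψ x = 0 := by
  refine Finset.sum_eq_zero fun i _ => partialDeriv_eq_zero_of_notMem fun h => hx ?_
  exact closure_mono (Function.support_comp_subset (g := fun v : Plane => v i) rfl ψ) h

theorem integrable_mul_divergence {D : Set Plane} {ψ : Plane → Plane} (hψ : ψ ∈ unitFields D)
    {w : Plane → ℝ} (hw : Continuous w) : Integrable fun x => w x * divergence ψ x :=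
  (hw.mul (continuous_divergence hψ)).integrable_of_hasCompactSupport
    (HasCompactSupport.intro (K := tsupport ψ) hψ.2.1 fun x hx => by
      rw [Pi.mul_apply, divergence_eq_zero_of_notMem hx, mul_zero])

theorem sum_partialDeriv_mul (w : Plane → ℝ) (x v : Plane) :
    ∑ i : Fin 2, partialDeriv i w x * v i = fderiv ℝ w x v := by
  have hv : v = ∑ i : Fin 2, v i • EuclideanSpace.single i (1 : ℝ) := by
    ext j
    fin_cases j <;> simp [Fin.sum_univ_two]
  conv_rhs => rw [hv]
  simp only [map_sum, map_smul, smul_eq_mul, partialDeriv]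
  exact Finset.sum_congr rfl fun i _ => mul_comm _ _

/-- Integration by parts and `‖ψ‖ ≤ 1`. This is the easy half of the identity between total
variation and the integral of the gradient norm, and the only half needed. -/
theorem ofReal_integral_mul_divergence_le {D : Set Plane} (hD : MeasurableSet D)
    {ψ : Plane → Plane} (hψ : ψ ∈ unitFields D) {w : Plane → ℝ} (hw : Differentiable ℝ w)
    (hwb : ∀ r : ℝ, ∃ C, ∀ x ∈ Metric.ball (0 : Plane) r, ‖fderiv ℝ w x‖ ≤ C) :
    ENNReal.ofReal (∫ x in D, w x * divergence ψ x) ≤ ∫⁻ x in D, ‖fderiv ℝ w x‖ₑ := by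
  have hψ0 : ∀ x, x ∉ D → ψ x = 0 := fun x hx =>
    image_eq_zero_of_notMem_tsupport fun h => hx (hψ.2.2.1 h)
  have h1 : ∫ x in D, w x * divergence ψ x = ∫ x, w x * divergence ψ x := by
    refine setIntegral_eq_integral_of_forall_compl_eq_zero fun x hx => ?_
    rw [divergence_eq_zero_of_notMem fun h => hx (hψ.2.2.1 h), mul_zero]
  have h2 : ∫ x, w x * divergence ψ x
      = ∑ i : Fin 2, ∫ x, w x * partialDeriv i (fun y => ψ y i) x := by
    simp only [divergence, Finset.mul_sum]
    refine integral_finsetSum _ fun i _ => ?_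
    exact (hw.continuous.mul (continuous_partialDeriv (contDiff_component hψ i) i)
      ).integrable_of_hasCompactSupport
      (hasCompactSupport_partialDeriv (hasCompactSupport_component hψ i) i).mul_left
  have h3 : ∀ i : Fin 2, Integrable fun x => partialDeriv i w x * ψ x i := by
    intro i
    have hci := hasCompactSupport_component hψ i
    obtain ⟨r, hr⟩ := hci.isCompact.isBounded.subset_ball (0 : Plane)
    obtain ⟨C, hC⟩ := hwb r
    have hI := (contDiff_component hψ i).continuous.integrable_of_hasCompactSupport
      (μ := volume) hci
    have hm : AEStronglyMeasurable (partialDeriv i w) :=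
      (measurable_fderiv_apply_const ℝ w _).aestronglyMeasurable
    refine (hI.norm.const_mul C).mono' (hm.mul hI.aestronglyMeasurable)
      (Eventually.of_forall fun x => ?_)
    rw [norm_mul]
    by_cases hx : x ∈ tsupport fun y => ψ y i
    · exact mul_le_mul_of_nonneg_right ((abs_partialDeriv_le i w x).trans (hC x (hr hx)))
        (norm_nonneg _)
    · rw [image_eq_zero_of_notMem_tsupport (f := fun y => ψ y i) hx]
      simp
  rw [h1, h2, Finset.sum_congr rfl fun i _ => integral_mul_partialDeriv hw hwb
    (contDiff_component hψ i) (hasCompactSupport_component hψ i) i, Finset.sum_neg_distrib,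
    ← integral_finsetSum _ fun i _ => h3 i]
  simp_rw [sum_partialDeriv_mul]
  refine (ENNReal.ofReal_le_ofReal (neg_le_abs _)).trans ?_
  rw [← Real.norm_eq_abs, ofReal_norm]
  refine (enorm_integral_le_lintegral_enorm _).trans ?_
  rw [← lintegral_indicator hD]
  refine lintegral_mono fun x => ?_
  by_cases hx : x ∈ D
  · rw [indicator_of_mem hx, ← ofReal_norm, ← ofReal_norm]
    refine ENNReal.ofReal_le_ofReal (((fderiv ℝ w x).le_opNorm _).trans ?_)
    exact mul_le_of_le_one_right (norm_nonneg _) (hψ.2.2.2 x)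
  · rw [indicator_of_notMem hx, hψ0 x hx, map_zero, enorm_zero]

/-- Splitting `v = w + (v - w)` in each competitor; used in both directions, it makes the total
variation continuous under `L¹` convergence of gradients. -/
theorem totalVariation_le_add {D : Set Plane} (hD : MeasurableSet D) {v w : Plane → ℝ}
    (hv : Differentiable ℝ v) (hw : Differentiable ℝ w)
    (hvb : ∀ r : ℝ, ∃ C, ∀ x ∈ Metric.ball (0 : Plane) r, ‖fderiv ℝ v x‖ ≤ C)
    (hwb : ∀ r : ℝ, ∃ C, ∀ x ∈ Metric.ball (0 : Plane) r, ‖fderiv ℝ w x‖ ≤ C) :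
    totalVariation v D ≤ totalVariation w D + ∫⁻ x in D, ‖fderiv ℝ v x - fderiv ℝ w x‖ₑ := by
  refine iSup₂_le fun ψ hψ => ?_
  have hfd : ∀ x, fderiv ℝ (fun y => v y - w y) x = fderiv ℝ v x - fderiv ℝ w x := fun x =>
    fderiv_fun_sub (hv x) (hw x)
  have h1 : ∫ x in D, v x * divergence ψ x
      = (∫ x in D, w x * divergence ψ x) + ∫ x in D, (v x - w x) * divergence ψ x := by
    rw [← integral_add (integrable_mul_divergence hψ hw.continuous).integrableOn
      (integrable_mul_divergence (w := fun x => v x - w x) hψ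
        (hv.continuous.sub hw.continuous)).integrableOn]
    refine integral_congr_ae (Eventually.of_forall fun x => ?_)
    simp only
    ring
  have h2 := ofReal_integral_mul_divergence_le hD hψ (w := fun y => v y - w y) (hv.sub hw) (by
    intro r
    obtain ⟨C₁, h1⟩ := hvb r
    obtain ⟨C₂, h2⟩ := hwb r
    refine ⟨C₁ + C₂, fun x hx => ?_⟩
    rw [hfd]
    exact (norm_sub_le _ _).trans (add_le_add (h1 x hx) (h2 x hx)))
  have h3 : ∫⁻ x in D, ‖fderiv ℝ (fun y => v y - w y) x‖ₑ
      = ∫⁻ x in D, ‖fderiv ℝ v x - fderiv ℝ w x‖ₑ := lintegral_congr fun x => by rw [hfd]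
  rw [h3] at h2
  rw [h1]
  refine ENNReal.ofReal_add_le.trans (add_le_add ?_ h2)
  exact le_iSup₂ (f := fun ψ (_ : ψ ∈ unitFields D) =>
    ENNReal.ofReal (∫ x in D, w x * divergence ψ x)) ψ hψ

theorem tendsto_strictDist {a r : ℝ} {w : ℕ → Plane → ℝ} {w₀ χ : Plane → ℝ}
    (hw : ∀ n, Differentiable ℝ (w n)) (hw₀ : Differentiable ℝ w₀)
    (hb : ∀ r : ℝ, ∃ C, (∀ n, ∀ x ∈ Metric.ball (0 : Plane) r, |w n x| ≤ C ∧
      ‖fderiv ℝ (w n) x‖ ≤ C) ∧ ∀ x ∈ Metric.ball (0 : Plane) r, |w₀ x| ≤ C ∧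
      ‖fderiv ℝ w₀ x‖ ≤ C)
    (hlim : ∀ x, Tendsto (fun n => w n x) atTop (𝓝 (w₀ x)) ∧
      Tendsto (fun n => fderiv ℝ (w n) x) atTop (𝓝 (fderiv ℝ w₀ x)))
    (hχm : Measurable χ) (hχ : ∀ x, |χ x| ≤ 1)
    (hT : totalVariation χ (Metric.ball 0 r) ≠ ⊤) :
    Tendsto (fun n => strictDist a (Metric.ball 0 r) (w n) χ) atTop
      (𝓝 (strictDist a (Metric.ball 0 r) w₀ χ)) := by
  obtain ⟨C, hC, hC₀⟩ := hb r
  have hconst : ∀ B : ℝ, ∫⁻ _ in Metric.ball (0 : Plane) r, ENNReal.ofReal B ≠ ⊤ := fun B => by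
    rw [setLIntegral_const]
    exact ENNReal.mul_ne_top ENNReal.ofReal_ne_top measure_ball_lt_top.ne
  have hL : Tendsto (fun n => ∫⁻ x in Metric.ball (0 : Plane) r, ENNReal.ofReal |w n x - χ x|)
      atTop (𝓝 (∫⁻ x in Metric.ball (0 : Plane) r, ENNReal.ofReal |w₀ x - χ x|)) := by
    refine tendsto_lintegral_of_dominated_convergence (fun _ => ENNReal.ofReal (C + 1))
      (fun n => ?_) (fun n => ?_) (hconst _) (Eventually.of_forall fun x => ?_)
    · have := (hw n).continuous.measurable
      exact ENNReal.measurable_ofReal.comp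
        (continuous_abs.measurable.comp (this.sub hχm))
    · rw [EventuallyLE, ae_restrict_iff' measurableSet_ball]
      refine Eventually.of_forall fun x hx => ENNReal.ofReal_le_ofReal ?_
      exact (abs_sub _ _).trans (add_le_add (hC n x hx).1 (hχ x))
    · exact (ENNReal.continuous_ofReal.tendsto _).comp
        ((continuous_abs.tendsto _).comp ((hlim x).1.sub_const _))
  set e : ℕ → ℝ≥0∞ := fun n =>
    ∫⁻ x in Metric.ball (0 : Plane) r, ‖fderiv ℝ (w n) x - fderiv ℝ w₀ x‖ₑ with he
  have hE : Tendsto e atTop (𝓝 0) := by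
    have hz : (0 : ℝ≥0∞) = ∫⁻ _ in Metric.ball (0 : Plane) r, 0 := by simp
    rw [hz]
    refine tendsto_lintegral_of_dominated_convergence (fun _ => ENNReal.ofReal (C + C))
      (fun n => ?_) (fun n => ?_) (hconst _) (Eventually.of_forall fun x => ?_)
    · exact ((measurable_fderiv ℝ (w n)).sub (measurable_fderiv ℝ w₀)).enorm
    · rw [EventuallyLE, ae_restrict_iff' measurableSet_ball]
      refine Eventually.of_forall fun x hx => ?_
      rw [← ofReal_norm]
      exact ENNReal.ofReal_le_ofReal
        ((norm_sub_le _ _).trans (add_le_add (hC n x hx).2 (hC₀ x hx).2))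
    · have h1 : Tendsto (fun n => fderiv ℝ (w n) x - fderiv ℝ w₀ x) atTop (𝓝 0) := by
        simpa using (hlim x).2.sub_const (fderiv ℝ w₀ x)
      have h2 := (ENNReal.continuous_ofReal.tendsto _).comp h1.norm
      rw [norm_zero, ENNReal.ofReal_zero] at h2
      refine h2.congr fun n => ?_
      simp only [Function.comp]
      rw [ofReal_norm]
  have hbn : ∀ n, ∀ r : ℝ, ∃ C, ∀ x ∈ Metric.ball (0 : Plane) r, ‖fderiv ℝ (w n) x‖ ≤ C :=
    fun n r => let ⟨C, h1, _⟩ := hb r; ⟨C, fun x hx => (h1 n x hx).2⟩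
  have hb0 : ∀ r : ℝ, ∃ C, ∀ x ∈ Metric.ball (0 : Plane) r, ‖fderiv ℝ w₀ x‖ ≤ C :=
    fun r => let ⟨C, _, h1⟩ := hb r; ⟨C, fun x hx => (h1 x hx).2⟩
  have hTV : Tendsto (fun n => totalVariation (w n) (Metric.ball 0 r)) atTop
      (𝓝 (totalVariation w₀ (Metric.ball 0 r))) := by
    have hup : Tendsto (fun n => totalVariation w₀ (Metric.ball 0 r) + e n) atTop
        (𝓝 (totalVariation w₀ (Metric.ball 0 r))) := by
      simpa using hE.const_add (totalVariation w₀ (Metric.ball 0 r))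
    have hdn : Tendsto (fun n => totalVariation w₀ (Metric.ball 0 r) - e n) atTop
        (𝓝 (totalVariation w₀ (Metric.ball 0 r))) := by
      have := ENNReal.Tendsto.sub (tendsto_const_nhds
        (x := totalVariation w₀ (Metric.ball 0 r)) (f := atTop)) hE (Or.inr ENNReal.zero_ne_top)
      rwa [tsub_zero] at this
    refine tendsto_of_tendsto_of_tendsto_of_le_of_le hdn hup (fun n => ?_) fun n =>
      totalVariation_le_add measurableSet_ball (hw n) hw₀ (hbn n) hb0
    refine tsub_le_iff_right.2
      ((totalVariation_le_add measurableSet_ball hw₀ (hw n) hb0 (hbn n)).trans_eq ?_)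
    simp only [he]
    congr 1
    refine lintegral_congr fun x => ?_
    rw [← ofReal_norm, ← ofReal_norm, norm_sub_rev]
  -- Finiteness of the variation of `χ` matters here: `⊤ - t` is discontinuous at `t = ⊤`.
  have hmax : Continuous fun t : ℝ≥0∞ => max (t - totalVariation χ (Metric.ball 0 r))
      (totalVariation χ (Metric.ball 0 r) - t) :=
    (ENNReal.continuous_sub_right _).max (ENNReal.continuous_sub_left hT)
  exact hL.add (ENNReal.Tendsto.const_mul ((hmax.tendsto _).comp hTV)
    (Or.inr ENNReal.ofReal_ne_top))

/-- The finite perimeter is given on the ball of radius `R + 1`, but the fidelity term lives on a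
ball of radius `R₁ + 1`. A cutoff equal to `1` near `Ω` moves fields from one ball to the other
without changing the integral against `charFn Ω`. -/
theorem totalVariation_charFn_le {Ω : Set Plane} {r s t : ℝ} (hr : 0 < r) (hΩ : Ω ⊆ Metric.ball 0 r)
    (hs : r < s) (ht : r ≤ t) :
    totalVariation (charFn Ω) (Metric.ball 0 t) ≤ totalVariation (charFn Ω) (Metric.ball 0 s) := by
  refine iSup₂_le fun ψ hψ => ?_
  let f : ContDiffBump (0 : Plane) := ⟨r, (r + s) / 2, hr, by linarith⟩
  let θ : Plane → Plane := fun x => f x • ψ x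
  have hθ : θ ∈ unitFields (Metric.ball 0 s) := by
    have hc : HasCompactSupport ((f : Plane → ℝ) • ψ) := HasCompactSupport.smul_left hψ.2.1
    refine ⟨f.contDiff.smul hψ.1, hc, ?_, fun x => ?_⟩
    · refine (closure_mono (Function.support_smul_subset_left f ψ)).trans ?_
      change tsupport f ⊆ _
      rw [f.tsupport_eq]
      exact Metric.closedBall_subset_ball (show (r + s) / 2 < s by linarith)
    · rw [norm_smul, Real.norm_of_nonneg f.nonneg]
      exact mul_le_one₀ f.le_one (norm_nonneg _) (hψ.2.2.2 x)
  have hχ0 : ∀ {t : ℝ}, r ≤ t → ∀ x, x ∉ Metric.ball (0 : Plane) t → charFn Ω x = 0 :=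
    fun ht x hx => indicator_of_notMem (fun h => hx (Metric.ball_subset_ball ht (hΩ h))) _
  have heq : ∫ x in Metric.ball (0 : Plane) t, charFn Ω x * divergence ψ x
      = ∫ x in Metric.ball (0 : Plane) s, charFn Ω x * divergence θ x := by
    rw [setIntegral_eq_integral_of_forall_compl_eq_zero (fun x hx => by
        rw [hχ0 ht x hx, zero_mul]),
      setIntegral_eq_integral_of_forall_compl_eq_zero (fun x hx => by
        rw [hχ0 hs.le x hx, zero_mul])]
    refine integral_congr_ae (Eventually.of_forall fun x => ?_)
    by_cases hx : x ∈ Ω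
    · have hev : θ =ᶠ[𝓝 x] ψ := by
        filter_upwards [Metric.isOpen_ball.mem_nhds (hΩ hx)] with y hy
        have : f y = 1 := f.one_of_mem_closedBall (Metric.ball_subset_closedBall hy)
        simp only [θ, this, one_smul]
      have : divergence θ x = divergence ψ x := by
        refine Finset.sum_congr rfl fun i _ => ?_
        have : (fun y => θ y i) =ᶠ[𝓝 x] fun y => ψ y i := by
          filter_upwards [hev] with y hy
          rw [hy]
        rw [partialDeriv, partialDeriv, this.fderiv_eq]
      simp only [this]
    · simp [charFn, hx]
  rw [heq]
  exact le_iSup₂ (f := fun ψ (_ : ψ ∈ unitFields (Metric.ball 0 s)) =>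
    ENNReal.ofReal (∫ x in Metric.ball (0 : Plane) s, charFn Ω x * divergence ψ x)) θ hθ

/-! ### Existence of minimizers -/

theorem lowerSemicontinuous_strictDist {K J : Plane → ℂ} (hK : ContDiff ℝ 1 K)
    (hJ : IsFourierOfNonneg J) {ϕ : ℝ → ℝ} (hϕ : ContDiff ℝ 1 ϕ) (h η a R r : ℝ) {χ : Plane → ℝ}
    (hχm : Measurable χ) (hχ : ∀ x, |χ x| ≤ 1)
    (hT : totalVariation χ (Metric.ball 0 r) ≠ ⊤) :
    LowerSemicontinuous fun u : phaseFields R =>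
      strictDist a (Metric.ball 0 r) (smoothPattern K J ϕ h η u.1) χ := by
  refine lowerSemicontinuous_of_seq fun u u₀ y _ hlim hle => ?_
  have hd : ∀ v : phaseFields R, Differentiable ℝ (smoothPattern K J ϕ h η v.1) := fun v x =>
    (hasFDerivAt_smoothPattern hK hJ hϕ h η v x).differentiableAt
  refine le_of_tendsto' (tendsto_strictDist (fun n => hd (u n)) (hd u₀) (fun r => ?_)
    (tendsto_smoothPattern hK hJ hϕ h η hlim) hχm hχ hT) hle
  obtain ⟨C, -, hC⟩ := exists_bound_smoothPattern (R := R) hK hJ hϕ h η r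
  exact ⟨C, fun n => hC (u n), hC u₀⟩

/-- The integrand converges pointwise, since `f` is continuous into `[0, ∞]`, and Fatou applies on
the whole plane. -/
theorem lowerSemicontinuous_regularization {K J : Plane → ℂ} (hK : ContDiff ℝ 1 K)
    (hJ : IsFourierOfNonneg J) {f : ℝ → ℝ≥0∞} (hf : Continuous f) {φ : ℝ → ℝ}
    (hφ : Continuous φ) (R : ℝ) :
    LowerSemicontinuous fun u : phaseFields R => regularization K J f φ u.1 := by
  refine lowerSemicontinuous_of_seq fun u u₀ y _ hlim hle => ?_
  calc regularization K J f φ u₀.1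
      = ∫⁻ x, liminf (fun n => f (‖gradient (intensity K J (u n).1) x‖ ^ 2
          - φ (intensity K J (u n).1 x))) atTop := by
        refine lintegral_congr fun x => ?_
        obtain ⟨h1, h2⟩ := tendsto_intensity hK hJ hlim x
        simp_rw [norm_gradient]
        exact ((hf.tendsto _).comp ((h2.norm.pow 2).sub ((hφ.tendsto _).comp h1))).liminf_eq.symm
    _ ≤ liminf (fun n => regularization K J f φ (u n).1) atTop := by
        refine lintegral_liminf_le fun n => ?_
        have hI := (differentiable_intensity hK hJ (u n)).continuous
        simp_rw [norm_gradient]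
        exact hf.measurable.comp (((measurable_fderiv ℝ _).norm.pow_const 2).sub
          (hφ.comp hI).measurable)
    _ ≤ y := liminf_le_of_frequently_le' (Frequently.of_forall fun n => hle n)

theorem modicaMortola_zeroField {p : ℝ} (hp : 1 < p) {W : ℝ → ℝ} (hW : W 0 = 0) (R ε : ℝ) :
    modicaMortola p W R ε (zeroField R).1 = 0 := by
  have hz := zeroField_ae R
  have hgz : gradient (fun _ : Plane => (0 : ℝ)) = fun _ => 0 := by
    ext x : 1
    simp [gradient]
  have hw0 : IsW0WithGradient p (Metric.ball 0 R) (zeroField R).1 fun _ => 0 := by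
    refine ⟨phaseFields_memLp _ _, MemLp.zero', fun ψ _ i => ?_, fun _ _ => 0, fun n => ?_, ?_, ?_⟩
    · rw [integral_eq_zero_of_ae (ae_restrict_of_ae (hz.mono fun x hx => by simp [hx]))]
      simp
    · exact ⟨contDiff_const, HasCompactSupport.zero, by simp [tsupport]⟩
    · refine tendsto_const_nhds.congr fun n => Eq.symm ?_
      refine (eLpNorm_congr_ae (ae_restrict_of_ae (hz.mono fun x hx => ?_))).trans eLpNorm_zero'
      simp [hx]
    · simp [hgz]
  refine le_antisymm ((iInf₂_le (f := fun (G : Plane → Plane)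
      (_ : IsW0WithGradient p (Metric.ball 0 R) (zeroField R).1 G ∧
      ∀ᵐ x ∂(volume : Measure Plane), x ∉ Metric.ball (0 : Plane) R → (zeroField R).1 x = 0) =>
    ENNReal.ofReal (wellConst p W / (Real.conjExponent p * ε)) *
        (∫⁻ x in Metric.ball (0 : Plane) R, ENNReal.ofReal (W ((zeroField R).1 x))) +
      ENNReal.ofReal (wellConst p W * ε ^ (p - 1) / p) *
        (∫⁻ x in Metric.ball (0 : Plane) R, ENNReal.ofReal (‖G x‖ ^ p)))
    (fun _ => 0) ⟨hw0, (zeroField R).2.2⟩).trans ?_) zero_le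
  have h1 : ∫⁻ x in Metric.ball (0 : Plane) R, ENNReal.ofReal (W ((zeroField R).1 x)) = 0 := by
    rw [lintegral_congr_ae (ae_restrict_of_ae (hz.mono fun x hx => by
      simp only [hx, hW, ENNReal.ofReal_zero]
      : ∀ᵐ x ∂volume, ENNReal.ofReal (W ((zeroField R).1 x)) = 0))]
    simp
  rw [h1]
  simp [Real.zero_rpow (zero_lt_one.trans hp).ne']

theorem strictDist_ne_top {a r : ℝ} {χ : Plane → ℝ} (hχ : ∀ x, |χ x| ≤ 1)
    (hT : totalVariation χ (Metric.ball 0 r) ≠ ⊤) :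
    strictDist a (Metric.ball 0 r) (fun _ => 0) χ ≠ ⊤ := by
  have h0 : totalVariation (fun _ => 0) (Metric.ball 0 r) = 0 := by simp [totalVariation]
  refine ENNReal.add_ne_top.2 ⟨ne_top_of_le_ne_top
    (b := ∫⁻ _ in Metric.ball (0 : Plane) r, 1) ?_ (lintegral_mono fun x => ?_),
    ENNReal.mul_ne_top ENNReal.ofReal_ne_top ?_⟩
  · rw [setLIntegral_const, one_mul]
    exact measure_ball_lt_top.ne
  · rw [zero_sub, abs_neg]
    exact ENNReal.ofReal_le_one.2 (hχ x)
  · rw [h0, zero_tsub, tsub_zero, max_eq_right zero_le]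
    exact hT

theorem smoothPattern_zeroField {K J : Plane → ℂ} (hK : ContDiff ℝ 1 K)
    (hJ : IsFourierOfNonneg J) {ϕ : ℝ → ℝ} (hϕ : ∀ t ≤ -(1 / 2 : ℝ), ϕ t = 0) {h η : ℝ}
    (hη : 0 < η) (hηh : η ≤ 2 * h) (R : ℝ) :
    smoothPattern K J ϕ h η (zeroField R).1 = fun _ => 0 := by
  ext x
  rw [smoothPattern, intensity_zeroField hK hJ]
  refine hϕ _ ?_
  rw [div_le_iff₀ hη]
  linarith

theorem regularization_zeroField {K J : Plane → ℂ} (hK : ContDiff ℝ 1 K)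
    (hJ : IsFourierOfNonneg J) {δ₀ : ℝ} {f : ℝ → ℝ≥0∞} (hf : ∀ s, δ₀ ≤ s → f s = 0) {φ : ℝ → ℝ}
    (hφ : φ 0 < -δ₀) (R : ℝ) : regularization K J f φ (zeroField R).1 = 0 := by
  have hgz : gradient (fun _ : Plane => (0 : ℝ)) = fun _ => 0 := by
    ext x : 1
    simp [gradient]
  have : f (-φ 0) = 0 := hf _ (by linarith)
  simp [regularization, intensity_zeroField hK hJ, hgz, this]

end Photolithography

/-! ### Assembly of the direct method. -/

theorem proposition3p7
    -- the optical system
    (α : ℝ≥0) (hα : 0 < α) (hα1 : α ≤ 1)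
    (K J : Plane → ℂ) (hK : IsC1Holder α K)
    (hK0 : Tendsto (fun x => ‖K x‖) (cocompact Plane) (𝓝 0))
    (hJ : IsFourierOfNonneg J)
    -- the threshold and the target pattern
    (h : ℝ) (hh : 0 < h) (R : ℝ) (hR : 0 < R)
    (Ω₀ : Set Plane) (hΩo : IsOpen Ω₀) (hΩc : closure Ω₀ ⊆ Metric.ball 0 R)
    (hΩP : totalVariation (charFn Ω₀) (Metric.ball 0 (R + 1)) < ⊤)
    -- the auxiliary functions of the regularization term
    (δ₀ : ℝ) (hδ₀ : 0 < δ₀)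
    (f : ℝ → ℝ≥0∞) (hfc : Continuous f) (hf_top : ∀ s ≤ 0, f s = ⊤) (hf_anti : Antitone f)
    (hf_zero : ∀ s, δ₀ ≤ s → f s = 0)
    (hf_lim : ∃ l : ℝ≥0∞, 0 < l ∧
      Tendsto (fun s : ℝ => f s * ENNReal.ofReal (s ^ (2 / (α : ℝ)))) (𝓝[>] 0) (𝓝 l))
    (φ : ℝ → ℝ) (hφ : ContDiff ℝ 1 φ) (hφh : 0 < φ h) (hφ_mono : MonotoneOn φ (Iic h))
    (hφ_anti : AntitoneOn φ (Ici h)) (hφ0 : φ 0 < -δ₀)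
    -- the smoothed Heaviside function
    (ϕ : ℝ → ℝ) (hϕ : ContDiff ℝ ∞ ϕ) (hϕ_mono : Monotone ϕ)
    (hϕ_zero : ∀ t ≤ -(1 / 2 : ℝ), ϕ t = 0) (hϕ_one : ∀ t, (1 / 2 : ℝ) ≤ t → ϕ t = 1)
    -- the approximations of the regularization term
    (Reg : ℝ → phaseFields R → ℝ≥0∞)
    (hReg_zero : ∀ u : phaseFields R, Reg 0 u = regularization K J f φ u.1)
    (hReg_lsc : ∀ g : ℝ, 0 < g → LowerSemicontinuous (Reg g))
    (hReg_anti : ∀ g₁ g₂ : ℝ, 0 < g₁ → g₁ < g₂ → ∀ u, Reg g₂ u ≤ Reg g₁ u)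
    (hReg_le : ∀ g : ℝ, 0 < g → ∀ u : phaseFields R, Reg g u ≤ regularization K J f φ u.1)
    (hReg_lim : ∀ u : phaseFields R,
      Tendsto (fun g => Reg g u) (𝓝[>] 0) (𝓝 (regularization K J f φ u.1)))
    -- the Modica-Mortola term
    (p : ℝ) (hp : 1 < p) (W : ℝ → ℝ) (hWc : Continuous W) (hW_nonneg : ∀ t, 0 ≤ W t)
    (hW_zero : ∀ t, W t = 0 ↔ t = 0 ∨ t = 1)
    -- the parameters; the fidelity term is computed on the ball of radius `R₁ + 1`
    (a b c : ℝ) (ha : 0 < a) (hb : 0 < b) (hc : 0 < c) (R₁ : ℝ) (hR₁ : R ≤ R₁)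
    (η : ℝ → ℝ) (hηc : ContinuousOn η (Ici 0)) (hη_mono : StrictMonoOn η (Ici 0)) (hη0 : η 0 = 0)
    (γ : ℝ → ℝ) (hγc : ContinuousOn γ (Ici 0)) (hγ_mono : MonotoneOn γ (Ici 0))
    (hγ0 : γ 0 = 0) :
    ∃ ε₀ : ℝ, 0 < ε₀ ∧ ∃ 𝒦 : Set (phaseFields R), IsCompact 𝒦 ∧
      ∀ ε : ℝ, 0 < ε → ε ≤ ε₀ → ∃ m : ℝ≥0∞,
        IsLeast (approxFunctional K J ϕ h Ω₀ p W R (R₁ + 1) a b c Reg η γ ε '' 𝒦) m ∧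
        IsLeast (range (approxFunctional K J ϕ h Ω₀ p W R (R₁ + 1) a b c Reg η γ ε)) m := by
  have hK1 := hK.1
  have hϕ1 : ContDiff ℝ 1 ϕ := hϕ.of_le (by exact_mod_cast le_top)
  have hΩR : Ω₀ ⊆ Metric.ball 0 R := subset_closure.trans hΩc
  set χ := charFn Ω₀ with hχdef
  have hχm : Measurable χ := measurable_const.indicator hΩo.measurableSet
  have hχ : ∀ x, |χ x| ≤ 1 := fun x => by
    by_cases hx : x ∈ Ω₀ <;> simp [hχdef, charFn, hx]
  have hT : totalVariation χ (Metric.ball 0 (R₁ + 1)) ≠ ⊤ :=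
    ((totalVariation_charFn_le hR hΩR (lt_add_one R) (by linarith)).trans_lt hΩP).ne
  have hWc0 := wellConst_pos hp hWc hW_nonneg hW_zero
  set C₀ : ℝ≥0∞ := strictDist a (Metric.ball 0 (R₁ + 1)) (fun _ => 0) χ with hC₀
  have hC₀t : C₀ ≠ ⊤ := strictDist_ne_top hχ hT
  have hb0 : ENNReal.ofReal b ≠ 0 := by simpa using hb
  -- This `d` serves as the threshold for `ε`: `η ε ≤ 2 * h` is what makes the smoothed pattern of
  -- the zero field vanish.
  obtain ⟨d, hd, hηd⟩ : ∃ d > 0, ∀ ε, 0 < ε → ε ≤ d → η ε ≤ 2 * h := by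
    have h1 : Tendsto η (𝓝[Ici 0] 0) (𝓝 0) := by
      have := hηc 0 self_mem_Ici
      rwa [ContinuousWithinAt, hη0] at this
    have h2 : ∀ᶠ x in 𝓝[Ici 0] 0, η x < 2 * h := h1.eventually (gt_mem_nhds (by linarith))
    obtain ⟨d, hd, hsub⟩ := Metric.mem_nhdsWithin_iff.1 h2
    refine ⟨d / 2, half_pos hd, fun ε hε hεd => ?_⟩
    have : ε ∈ Metric.ball (0 : ℝ) d ∩ Ici 0 := by
      refine ⟨?_, hε.le⟩
      rw [mem_ball_zero_iff, Real.norm_of_nonneg hε.le]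
      linarith
    exact (hsub this).le
  obtain ⟨L, hL⟩ := exists_lipschitzWith_profile hp hWc
  -- The constant `C₀ / b` is the bound on `P_ε` over the fields with energy at most `C₀`, so `𝒦` is
  -- fixed before `ε`.
  set 𝒦 := translationBounded (profile p W) R (C₀ / ENNReal.ofReal b).toReal with h𝒦
  have h𝒦c : IsCompact 𝒦 := isCompact_translationBounded hL (profile_zero p W)
    (strictMonoOn_profile hp hWc hW_nonneg hW_zero) R ENNReal.toReal_nonneg
  refine ⟨d, hd, 𝒦, h𝒦c, fun ε hε hεd => ?_⟩
  have hηε : 0 < η ε := by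
    rw [← hη0]
    exact hη_mono self_mem_Ici hε.le hε
  have hγε : 0 ≤ γ ε := by
    rw [← hγ0]
    exact hγ_mono self_mem_Ici hε.le hε.le
  set F := approxFunctional K J ϕ h Ω₀ p W R (R₁ + 1) a b c Reg η γ ε with hF
  -- As `γ` is only nondecreasing, `γ ε = 0` can occur; semicontinuity is then that of the
  -- unapproximated term.
  have hReg : LowerSemicontinuous (Reg (γ ε)) := by
    rcases hγε.eq_or_lt with h0 | h0
    · have : Reg (γ ε) = fun u => regularization K J f φ u.1 := by
        rw [← h0]
        exact funext hReg_zero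
      rw [this]
      exact lowerSemicontinuous_regularization hK1 hJ hfc hφ.continuous R
    · exact hReg_lsc _ h0
  have hFlsc : LowerSemicontinuous F :=
    ((lowerSemicontinuous_strictDist hK1 hJ hϕ1 h (η ε) a R (R₁ + 1) hχm hχ hT).add
      (lowerSemicontinuous_ofReal_mul b
        (lowerSemicontinuous_modicaMortola hp hWc hWc0 R hε))).add
      (lowerSemicontinuous_ofReal_mul c hReg)
  have hF0 : F (zeroField R) ≤ C₀ := by
    have h1 : Reg (γ ε) (zeroField R) = 0 := by
      rcases hγε.eq_or_lt with h0 | h0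
      · rw [← h0, hReg_zero, regularization_zeroField hK1 hJ hf_zero hφ0]
      · refine le_antisymm ((hReg_le _ h0 _).trans_eq ?_) zero_le
        exact regularization_zeroField hK1 hJ hf_zero hφ0 R
    rw [hF, approxFunctional, h1, modicaMortola_zeroField hp ((hW_zero 0).2 (Or.inl rfl)),
      smoothPattern_zeroField hK1 hJ hϕ_zero hηε (hηd ε hε hεd), mul_zero, mul_zero, add_zero,
      add_zero]
  have hsub : ∀ u, F u ≤ C₀ → u ∈ 𝒦 := by
    intro u hu τ
    have h1 : ENNReal.ofReal b * modicaMortola p W R ε u.1 ≤ C₀ :=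
      (le_add_self.trans le_self_add).trans hu
    have h2 : modicaMortola p W R ε u.1 ≤ C₀ / ENNReal.ofReal b := by
      rw [ENNReal.le_div_iff_mul_le (Or.inl hb0) (Or.inl ENNReal.ofReal_ne_top), mul_comm]
      exact h1
    refine (lintegral_profile_translation_le hp hWc hW_nonneg hWc0 hε u τ).trans ?_
    rw [ENNReal.ofReal_mul ENNReal.toReal_nonneg,
      ENNReal.ofReal_toReal (ENNReal.div_ne_top hC₀t hb0), ofReal_norm]
    gcongr
  obtain ⟨u₀, hu₀, hmin⟩ := (hFlsc.lowerSemicontinuousOn 𝒦).exists_isMinOn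
    ⟨zeroField R, hsub _ hF0⟩ h𝒦c
  refine ⟨F u₀, ⟨⟨u₀, hu₀, rfl⟩, ?_⟩, ⟨u₀, rfl⟩, ?_⟩
  · rintro _ ⟨u, hu, rfl⟩
    exact hmin hu
  · rintro _ ⟨u, rfl⟩
    -- A field with energy above `C₀` is beaten by the zero field, which lies in `𝒦`.
    by_cases hu : F u ≤ C₀
    · exact hmin (hsub u hu)
    · exact (hmin (hsub _ hF0)).trans (hF0.trans (not_le.1 hu).le)
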